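/- Let $d\ge 1$ and $D=d^2$. Let $\mathrm{PU}(d)=\mathrm U(d)/\mathrm U(1)$ (unitaries up to a phase), let $\mu$ be its Haar measure with $\mu(\mathrm{PU}(d))=1$, and for $x\in\mathrm{PU}(d)$ let $U(x)\in\mathrm U(d)$ be a representative. For $V\in\mathrm U(d)$ put $|V\rangle=\frac1{\sqrt d}\sum_k V|k\rangle\otimes|k\rangle$, so that $|V\rangle\langle V|$ is a maximally entangled state of $\mathbb C^d\otimes\mathbb C^d$. Let $\mathscr Q^{\mathrm{uc}}$ be the set of all states $\rho$ of $\mathbb C^d\otimes\mathbb C^d$ ($\rho\ge0$, $\operatorname{tr}\rho=1$) both of whose partial traces equal $I/d$ (the outputs $(\mathcal E\otimes\mathcal I)(|I\rangle\langle I|)$ of unital channels $\mathcal E$). Let $\mathscr X\subseteq\mathrm{PU}(d)$ carry its Borel $\sigma$-algebra and let $F$ be a POVM on $\mathscr X$ acting on $\mathbb C^d\otimes\mathbb C^d$: a countably additive map $E\mapsto F(E)\ge0$ with $F(\mathscr X)=I$. Let $\tau(E)=\operatorname{tr}F(E)$ be its trace measure and $P$ its density, i.e. the Radon–Nikodym derivative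 of $F$ with respect to $\tau$, so that $F(E)=\int_E P\,\mathrm d\tau$. Put $P_0=P-I/D$ and define the superoperators $$\mathcal F(A)=\int_{\mathscr X}\mathrm d\tau(x)\,\operatorname{tr}[P(x)A]\,P(x),\qquad \mathcal F_0(A)=\int_{\mathscr X}\mathrm d\tau(x)\,\operatorname{tr}[P_0(x)A]\,P_0(x)$$ on the real space of Hermitian operators with the Hilbert–Schmidt inner product; the support of such a superoperator is its image. $F$ is called tight if $\mathcal F_0=a\,\Pi$ for some $a>0$, where $\Pi$ is the orthogonal projector onto $\operatorname{supp}(\mathcal F_0)$, and rank-one if $P(x)$ has rank one for $\tau$-almost every $x$. A weighted unitary $2$-design is a finite set $\mathscr D\subset\mathrm{PU}(d)$ with a weight function $w:\mathscr D\to(0,1]$ such that $\sum_{x\in\mathscr D}w(x)=1$ and $\sum_{x\in\mathscr D}w(x)\,U(x)^{\otimes2}\otimes(U(x)^{\otimes2})^\dagger=\int_{\mathrm{PU}(d)}\mathrm d\mu(x)\,U(x)^{\otimes2}\otimes(U(x)^{\otimes2})^\dagger$. Assume that $\operatorname{supp}(\mathcal F)$ is the real linear span of $\mathscr Q^{\mathrm{uc}}$.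 (1) $F$ is a tight rank-one POVM if and only if there is a function $V:\mathscr X\to\mathrm U(d)$ such that $P(x)=|V(x)\rangle\langle V(x)|$ for $\tau$-almost every $x$ and $$\frac1{d^2}\int_{\mathscr X}\mathrm d\tau(x)\,V(x)^{\otimes2}\otimes\big(V(x)^{\otimes2}\big)^\dagger=\int_{\mathrm{PU}(d)}\mathrm d\mu(x)\,U(x)^{\otimes2}\otimes\big(U(x)^{\otimes2}\big)^\dagger .\qquad(*)$$ If $\mathscr X$ is finite, the same equivalence holds with $(*)$ replaced by the condition that the image of $\tau/d^2$ under $x\mapsto[V(x)]\in\mathrm{PU}(d)$, restricted to the points of positive weight, is a weighted unitary $2$-design. (2) Suppose moreover that the outcomes are labelled by their unitaries: for $\tau$-almost every $x$, if $P(x)=|W\rangle\langle W|$ with $W\in\mathrm U(d)$, then $W$ belongs to the class $x$. Then $F$ is a tight rank-one POVM if and only if $P(x)=|U(x)\rangle\langle U(x)|$ for $\tau$-almost every $x$ and $(*)$ holds with $V(x)=U(x)$. If $\mathscr X$ is finite, the latter condition may be replaced by the condition that $(\mathscr X,\tau/d^2)$, restricted to the outcomes of positive weight, is a weighted unitary $2$-design.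 -/

import Mathlib

open MeasureTheory Filter Topology
open scoped ENNReal Matrix Kronecker ComplexOrder

noncomputable section

namespace QuantumProcess

/-! ### The projective unitary group and its Haar measure -/

/-- The unitary group `U(d)`. -/
abbrev U (d : ℕ) := Matrix.unitaryGroup (Fin d) ℂ

/-- The subgroup `U(1)` of phases `z I`, `|z| = 1`. -/
def phases (d : ℕ) : Subgroup (U d) where
  carrier := {V | ∃ z : ℂ, ‖z‖ = 1 ∧ (V : Matrix (Fin d) (Fin d) ℂ) = z • 1}
  one_mem' := ⟨1, by simp, by simp⟩
  mul_mem' := by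
    rintro A B ⟨z, hz, hA⟩ ⟨w, hw, hB⟩
    exact ⟨z * w, by simp [hz, hw], by simp [hA, hB, smul_smul, mul_comm]⟩
  inv_mem' := by
    rintro A ⟨z, hz, hA⟩
    refine ⟨star z, by simp [hz], ?_⟩
    have h : ((A⁻¹ : U d) : Matrix (Fin d) (Fin d) ℂ)
        = star (A : Matrix (Fin d) (Fin d) ℂ) := rfl
    rw [h, hA, star_smul, star_one]

instance phases_normal (d : ℕ) : (phases d).Normal where
  conj_mem := by
    rintro A ⟨z, hz, hA⟩ g
    refine ⟨z, hz, ?_⟩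
    have h : (g : Matrix (Fin d) (Fin d) ℂ) * ((g⁻¹ : U d) : Matrix (Fin d) (Fin d) ℂ) = 1 := by
      simp
    have h2 : ((g * A * g⁻¹ : U d) : Matrix (Fin d) (Fin d) ℂ)
        = (g : Matrix (Fin d) (Fin d) ℂ) * (A : Matrix (Fin d) (Fin d) ℂ)
          * ((g⁻¹ : U d) : Matrix (Fin d) (Fin d) ℂ) := rfl
    rw [h2, hA, Matrix.mul_smul, Matrix.mul_one, Matrix.smul_mul, h]

/-- The projective unitary group `PU(d) = U(d) / U(1)`. -/
def PU (d : ℕ) := U d ⧸ phases d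

instance (d : ℕ) : Group (PU d) := inferInstanceAs (Group (U d ⧸ phases d))
instance (d : ℕ) : TopologicalSpace (PU d) :=
  inferInstanceAs (TopologicalSpace (U d ⧸ phases d))
instance (d : ℕ) : IsTopologicalGroup (PU d) :=
  inferInstanceAs (IsTopologicalGroup (U d ⧸ phases d))
instance (d : ℕ) : MeasurableSpace (PU d) := borel (PU d)
instance (d : ℕ) : BorelSpace (PU d) := ⟨rfl⟩

instance compactSpace_U (d : ℕ) : CompactSpace (U d) := by
  refine isCompact_iff_compactSpace.1 (?_ : IsCompact
    ((Matrix.unitaryGroup (Fin d) ℂ : Submonoid _) : Set (Matrix (Fin d) (Fin d) ℂ)))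
  have hK : IsCompact (Set.pi Set.univ fun _ : Fin d => Set.pi Set.univ fun _ : Fin d =>
      Metric.closedBall (0 : ℂ) 1) :=
    isCompact_univ_pi fun _ => isCompact_univ_pi fun _ => isCompact_closedBall 0 1
  refine IsCompact.of_isClosed_subset (X := Matrix (Fin d) (Fin d) ℂ) hK ?_ ?_
  · have : ((Matrix.unitaryGroup (Fin d) ℂ : Submonoid _) : Set (Matrix (Fin d) (Fin d) ℂ))
        = {A | A * star A = 1} := by
      ext A
      exact Matrix.mem_unitaryGroup_iff
    rw [this]
    exact isClosed_eq (by fun_prop) continuous_const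
  · intro A hA i _ j _
    simpa using entry_norm_bound_of_unitary hA i j

instance compactSpace_PU (d : ℕ) : CompactSpace (PU d) :=
  inferInstanceAs (CompactSpace (U d ⧸ phases d))

/-- The Haar measure on `PU(d)`, normalised by `μ(PU(d)) = 1`. -/
def haarPU (d : ℕ) : Measure (PU d) := Measure.haarMeasure ⊤

/-- The class in `PU(d)` of a unitary. -/
def cls {d : ℕ} (V : U d) : PU d := (QuotientGroup.mk V : U d ⧸ phases d)

/-- `U(x)`: a representative of the class `x ∈ PU(d)`. -/
def rep {d : ℕ} (x : PU d) : U d := Quotient.out (s := QuotientGroup.leftRel (phases d)) x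

/-! ### Matrices and superoperators -/

/-- Entrywise integral of a matrix-valued function. -/
def mInt {X m n : Type*} [MeasurableSpace X] (ν : Measure X) (f : X → Matrix m n ℂ) :
    Matrix m n ℂ :=
  Matrix.of fun i j => ∫ x, f x i j ∂ν

/-- The tensor power `A^{⊗t}`, with the tensor power of the index set modelled by `Fin t → n`. -/
def tensorPow {n : Type*} (t : ℕ) (A : Matrix n n ℂ) : Matrix (Fin t → n) (Fin t → n) ℂ :=
  Matrix.of fun i j => ∏ k, A (i k) (j k)

/-- `V^{⊗t} ⊗ (V^{⊗t})†`. -/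
def moment {d : ℕ} (t : ℕ) (V : U d) :
    Matrix ((Fin t → Fin d) × (Fin t → Fin d)) ((Fin t → Fin d) × (Fin t → Fin d)) ℂ :=
  tensorPow t (V : Matrix (Fin d) (Fin d) ℂ) ⊗ₖ (tensorPow t (V : Matrix (Fin d) (Fin d) ℂ))ᴴ

/-- The operator ket `|A⟩⟩`. -/
def opKet {n : Type*} (A : Matrix n n ℂ) : n × n → ℂ := fun p => A p.1 p.2

/-- Superoperators on `End(ℂ^n)`, as matrices acting on operator kets (the left-right action). -/
abbrev Superop (n : Type*) := Matrix (n × n) (n × n) ℂ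

/-- `|A⟩⟩⟨⟨B|`, the map `C ↦ tr(B† C) A`. -/
def opKetBra {n : Type*} (A B : Matrix n n ℂ) : Superop n :=
  Matrix.vecMulVec (opKet A) (star (opKet B))

/-- The left-right action of a superoperator, as a real-linear map on operators. -/
def Superop.act {n : Type*} [Fintype n] (S : Superop n) : Matrix n n ℂ →ₗ[ℝ] Matrix n n ℂ where
  toFun A := Matrix.of fun i j => (S *ᵥ opKet A) (i, j)
  map_add' A B := by
    have h : opKet (A + B) = opKet A + opKet B := rfl
    ext i j
    simp [h, Matrix.mulVec_add]
  map_smul' r A := by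
    have h : opKet (r • A) = r • opKet A := rfl
    ext i j
    simp [h, Matrix.mulVec_smul]

/-- The support of a Hermitian superoperator on the real space `H(ℂ^n)` of Hermitian operators:
the image of that space. -/
def Superop.supp {n : Type*} [Fintype n] (S : Superop n) : Submodule ℝ (Matrix n n ℂ) :=
  (selfAdjoint.submodule ℝ (Matrix n n ℂ)).map S.act

/-- `S` is the orthogonal projector (for the Hilbert-Schmidt inner product) of `H(ℂ^n)` onto the
subspace `W`. -/
def Superop.IsProjectorOnto {n : Type*} [Fintype n] (S : Superop n)
    (W : Submodule ℝ (Matrix n n ℂ)) : Prop :=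
  IsStarProjection S ∧ S.supp = W

/-! ### Positive-operator-valued measures -/

/-- A POVM on the outcome space `X`, acting on `ℂ^n`. -/
structure POVM (X : Type*) [MeasurableSpace X] (n : Type*) [Fintype n] [DecidableEq n] where
  /-- the underlying countably additive operator-valued set function -/
  toVec : VectorMeasure X (Matrix n n ℂ)
  posSemidef : ∀ E, MeasurableSet E → (toVec E).PosSemidef
  map_univ : toVec Set.univ = 1

namespace POVM

variable {X : Type*} [MeasurableSpace X] {n : Type*} [Fintype n] [DecidableEq n]

/-- The trace measure `τ(E) = tr F(E)`. -/
def traceMeasure (F : POVM X n) : Measure X :=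
  Measure.ofMeasurable (fun E _ => ENNReal.ofReal (F.toVec E).trace.re)
    (by simp)
    (by
      intro f hf hd
      have h0 : ∀ i, 0 ≤ (F.toVec (f i)).trace.re := fun i =>
        (Complex.le_def.1 (F.posSemidef _ (hf i)).trace_nonneg).1
      have hs : HasSum (fun i => (F.toVec (f i)).trace.re) (F.toVec (⋃ i, f i)).trace.re :=
        ((F.toVec.m_iUnion hf hd).map
          (Complex.reAddGroupHom.comp (Matrix.traceAddMonoidHom n ℂ))
          (Complex.continuous_re.comp (continuous_id.matrix_trace)))
      rw [← hs.tsum_eq, ENNReal.ofReal_tsum_of_nonneg h0 hs.summable])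

/-- The matrix element `E ↦ F(E)_{ij}`, a complex measure. -/
def entry (F : POVM X n) (i j : n) : ComplexMeasure X :=
  F.toVec.mapRange (Matrix.entryAddMonoidHom ℂ i j) (continuous_id.matrix_elem i j)

/-- The density `P` of `F`: the Radon-Nikodym derivative of `F` with respect to `τ`. -/
def density (F : POVM X n) (x : X) : Matrix n n ℂ :=
  Matrix.of fun i j => (F.entry i j).rnDeriv F.traceMeasure x

/-- The frame superoperator `𝓕 = ∫ dτ(x) |P(x)⟩⟩⟨⟨P(x)|`. -/
def frameOp (F : POVM X n) : Superop n :=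
  mInt F.traceMeasure fun x => opKetBra (F.density x) (F.density x)

/-- `P₀ = P - I/D`. -/
def density₀ (F : POVM X n) (x : X) : Matrix n n ℂ :=
  F.density x - ((Fintype.card n : ℂ)⁻¹) • (1 : Matrix n n ℂ)

/-- `𝓕₀ = ∫ dτ(x) |P₀(x)⟩⟩⟨⟨P₀(x)|`. -/
def frameOp₀ (F : POVM X n) : Superop n :=
  mInt F.traceMeasure fun x => opKetBra (F.density₀ x) (F.density₀ x)

/-- `F` is tight: `𝓕₀ = a Π` with `a > 0` and `Π` the orthogonal projector onto `supp 𝓕₀`. -/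
def IsTight (F : POVM X n) : Prop :=
  ∃ a : ℝ, 0 < a ∧ ∃ Q : Superop n,
    Q.IsProjectorOnto F.frameOp₀.supp ∧ F.frameOp₀ = (a : ℂ) • Q

/-- `F` is a rank-one POVM: its density has unit rank, `τ`-almost everywhere. -/
def IsRankOne (F : POVM X n) : Prop :=
  ∀ᵐ x ∂F.traceMeasure, (F.density x).rank = 1

end POVM

/-! ### System and ancilla -/

/-- The index set of the product basis of `ℂ^d ⊗ ℂ^d` (system, ancilla). -/
abbrev I2 (d : ℕ) := Fin d × Fin d

/-- The partial trace over the system (first factor). -/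
def trS {d : ℕ} (A : Matrix (I2 d) (I2 d) ℂ) : Matrix (Fin d) (Fin d) ℂ :=
  Matrix.of fun k l => ∑ j, A (j, k) (j, l)

/-- The partial trace over the ancilla (second factor). -/
def trA {d : ℕ} (A : Matrix (I2 d) (I2 d) ℂ) : Matrix (Fin d) (Fin d) ℂ :=
  Matrix.of fun i j => ∑ k, A (i, k) (j, k)

/-- `𝒬^uc`: the states of `ℂ^d ⊗ ℂ^d` both of whose partial traces are `I/d`. -/
def Quc (d : ℕ) : Set (Matrix (I2 d) (I2 d) ℂ) :=
  {ρ | ρ.PosSemidef ∧ ρ.trace = 1 ∧ trS ρ = (d : ℂ)⁻¹ • 1 ∧ trA ρ = (d : ℂ)⁻¹ • 1}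

/-- `|V⟩ = d^{-1/2} ∑ₖ V|k⟩ ⊗ |k⟩`. -/
def unitaryKet {d : ℕ} (V : U d) : I2 d → ℂ :=
  fun p => ((Real.sqrt d : ℝ) : ℂ)⁻¹ * (V : Matrix (Fin d) (Fin d) ℂ) p.1 p.2

/-- The maximally entangled state `|V⟩⟨V|`. -/
def unitaryState {d : ℕ} (V : U d) : Matrix (I2 d) (I2 d) ℂ :=
  Matrix.vecMulVec (unitaryKet V) (star (unitaryKet V))

/-! ### Designs -/

/-- The Haar moment `∫ dμ(x) U(x)^{⊗t} ⊗ (U(x)^{⊗t})†` over `PU(d)`. -/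
def haarMoment (t d : ℕ) :
    Matrix ((Fin t → Fin d) × (Fin t → Fin d)) ((Fin t → Fin d) × (Fin t → Fin d)) ℂ :=
  mInt (haarPU d) fun y => moment t (rep y)

/-- `(D, w)` is a weighted unitary `t`-design in dimension `d`. -/
def IsWeightedDesign (t : ℕ) {d : ℕ} (D : Set (PU d)) (w : PU d → ℝ) : Prop :=
  D.Finite ∧ (∀ y ∈ D, 0 < w y ∧ w y ≤ 1) ∧ ∑ᶠ y ∈ D, w y = 1 ∧
    ∑ᶠ y ∈ D, (w y : ℂ) • moment t (rep y) = haarMoment t d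

namespace POVM

variable {X : Type*} [MeasurableSpace X] {d : ℕ}

/-- `P(x) = |V(x)⟩⟨V(x)|` for `τ`-almost every `x`. -/
def HasUnitaryDensity (F : POVM X (I2 d)) (V : X → U d) : Prop :=
  ∀ᵐ x ∂F.traceMeasure, F.density x = unitaryState (V x)

/-- `(1/d²) ∫ dτ(x) V(x)^{⊗2} ⊗ (V(x)^{⊗2})† = ∫ dμ(y) U(y)^{⊗2} ⊗ (U(y)^{⊗2})†`. -/
def HasHaarSecondMoment (F : POVM X (I2 d)) (V : X → U d) : Prop :=
  ((d : ℂ) ^ 2)⁻¹ • mInt F.traceMeasure (fun x => moment 2 (V x)) = haarMoment 2 d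

/-- The weight `τ({x | [V(x)] = y}) / d²` that the outcome distribution gives to `y ∈ PU(d)`. -/
def weight (F : POVM X (I2 d)) (V : X → U d) (y : PU d) : ℝ :=
  F.traceMeasure.real {x | cls (V x) = y} / (d : ℝ) ^ 2

/-- The outcomes, as classes in `PU(d)`, that have positive probability. -/
def atoms (F : POVM X (I2 d)) (V : X → U d) : Set (PU d) :=
  {y | 0 < F.weight V y}

end POVM

end QuantumProcess

end

noncomputable section

/-! ### Pure states as rank-one matrices. -/

namespace QuantumProcess

/-! Everything reduces to computing one superoperator. The density `P` is almost everywhere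
Hermitian of trace one, so rank one makes it a pure state. The pairing `⟨C, 𝓕(C)⟩ = ∫ |tr(P C)|² dτ`
turns the hypothesis on the support into pointwise information: a Hermitian `C` orthogonal to `𝒬^uc`
is orthogonal to `𝓕(C)`, hence to almost every `P(x)`. With `C` built from `B ⊗ 1`, `tr B = 0`, this
forces the marginal `trA P` to be `I/d`, and a pure state with that marginal, reshaped into a square
matrix, is `|V⟩⟨V|` with `V` unitary (`exists_hasUnitaryDensity`).

For pure densities `𝓕` preserves the trace and `𝓕₀ = 𝓕 - |1⟩⟩⟨⟨1|/D`. The real span of `𝒬^uc`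
contains the Hermitian operators with vanishing marginals, and removing the trace part of an element
of the span leaves such an operator. Hence the support hypothesis identifies `supp 𝓕₀` with the
range of the explicit projector `marginalFreeProj`. Tightness then means `𝓕₀ = a Π` for this `Π`,
and comparing traces gives `a = 1/(d² - 1)` (`IsTight.frameOp_eq`; converse
`isTight_of_frameOp_eq`).

When `P = |V⟩⟨V|`, the entries of `𝓕` are those of the second moment of `V` in another order. The
Haar moment, in the same order, is also `|1⟩⟩⟨⟨1|/d² + Π/(d² - 1)` (`haarMoment_two_eq`), because
twirled matrices commute with every `W ⊗ W` and such matrices are determined by two contractions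
(`apply_of_commute_kronecker`). So `(*)` and tightness are the same equation for `𝓕`. In dimension
one both hold trivially.

For finite outcome spaces, grouping outcomes by class turns the integral in `(*)` into the design
sum. Part (2) holds because states and moments depend only on the class of a unitary, which the
labelling prescribes. -/

/-- A rank-one orthogonal projector, i.e. a pure state. -/
def IsPureState {n : Type*} [Fintype n] (ρ : Matrix n n ℂ) : Prop :=
  ρ.IsHermitian ∧ ρ * ρ = ρ ∧ ρ.trace = 1

theorem exists_eq_vecMulVec_of_rank_eq_one {n : Type*} [Fintype n] [DecidableEq n]
    {A : Matrix n n ℂ} (hA : A.rank = 1) : ∃ u w : n → ℂ, A = Matrix.vecMulVec u w := by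
  obtain ⟨u, -, hu⟩ := finrank_eq_one_iff'.1 (show Module.finrank ℂ A.mulVecLin.range = 1 from hA)
  choose c hc using fun j => hu ⟨A *ᵥ Pi.single j 1, ⟨Pi.single j 1, rfl⟩⟩
  refine ⟨u, c, ?_⟩
  ext i j
  have h := congrFun (congrArg Subtype.val (hc j)) i
  simp only [Submodule.coe_smul, Pi.smul_apply, smul_eq_mul, Matrix.mulVec_single_one,
    Matrix.col_apply] at h
  rw [Matrix.vecMulVec_apply, ← h, mul_comm]

/-- A rank-one matrix `A = u wᵀ` satisfies `A² = (w · u) A`, and `w · u` is its trace. -/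
theorem isPureState_of_rank_eq_one {n : Type*} [Fintype n] [DecidableEq n] {A : Matrix n n ℂ}
    (hA : A.rank = 1) (hH : A.IsHermitian) (ht : A.trace = 1) : IsPureState A := by
  refine ⟨hH, ?_, ht⟩
  obtain ⟨u, w, rfl⟩ := exists_eq_vecMulVec_of_rank_eq_one hA
  rw [Matrix.trace_vecMulVec] at ht
  rw [Matrix.vecMulVec_mul_vecMulVec, dotProduct_comm, ht, one_smul]

/-- Hermitian idempotence gives `ρᵢᵢ = ∑ⱼ |ρᵢⱼ|²`, which bounds first the diagonal and then every
entry. The bound makes all integrands quadratic in the density integrable. -/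
theorem IsPureState.norm_apply_le {n : Type*} [Fintype n] {ρ : Matrix n n ℂ} (h : IsPureState ρ)
    (i j : n) : ‖ρ i j‖ ≤ 1 := by
  have hs : ∀ i, ρ i i = ((∑ j, ‖ρ i j‖ ^ 2 : ℝ) : ℂ) := fun i => by
    conv_lhs => rw [← h.2.1]
    rw [Matrix.mul_apply, Complex.ofReal_sum]
    refine Finset.sum_congr rfl fun j _ => ?_
    rw [← h.1.apply j i, Complex.ofReal_pow, ← Complex.mul_conj', starRingEnd_apply]
  have hle : ∀ i j, ‖ρ i j‖ ^ 2 ≤ ‖ρ i i‖ := fun i j => by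
    rw [hs i, Complex.norm_real, Real.norm_of_nonneg (by positivity)]
    exact Finset.single_le_sum (f := fun j => ‖ρ i j‖ ^ 2) (fun _ _ => by positivity)
      (Finset.mem_univ j)
  have h1 : ‖ρ i i‖ ≤ 1 := by nlinarith [hle i i, norm_nonneg (ρ i i)]
  nlinarith [hle i j, norm_nonneg (ρ i j)]

theorem isPureState_vecMulVec {n : Type*} [Fintype n] {u : n → ℂ} (hu : star u ⬝ᵥ u = 1) :
    IsPureState (Matrix.vecMulVec u (star u)) := by
  refine ⟨?_, ?_, ?_⟩
  · rw [Matrix.IsHermitian, Matrix.conjTranspose_vecMulVec, star_star]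
  · rw [Matrix.vecMulVec_mul_vecMulVec, hu, one_smul]
  · rw [Matrix.trace_vecMulVec, dotProduct_comm, hu]

theorem rank_vecMulVec_eq_one {n : Type*} [Fintype n] [DecidableEq n] {u : n → ℂ}
    (hu : star u ⬝ᵥ u = 1) : (Matrix.vecMulVec u (star u)).rank = 1 := by
  refine le_antisymm (Matrix.rank_vecMulVec_le _ _) (Nat.one_le_iff_ne_zero.2 fun h => ?_)
  rw [Matrix.rank, Submodule.finrank_eq_zero, LinearMap.range_eq_bot] at h
  have h1 := LinearMap.congr_fun h u
  rw [Matrix.mulVecLin_apply, Matrix.vecMulVec_mulVec, hu, MulOpposite.op_one, one_smul] at h1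
  rw [show u = 0 from h1] at hu
  simp at hu

/-! ### Trace measure and density of a POVM. -/

namespace POVM

variable {X : Type*} [MeasurableSpace X] {n : Type*} [Fintype n] [DecidableEq n] (F : POVM X n)

theorem traceMeasure_apply {E : Set X} (hE : MeasurableSet E) :
    F.traceMeasure E = ENNReal.ofReal (F.toVec E).trace.re :=
  Measure.ofMeasurable_apply E hE

instance : IsFiniteMeasure F.traceMeasure :=
  ⟨by rw [F.traceMeasure_apply MeasurableSet.univ]; exact ENNReal.ofReal_lt_top⟩

theorem traceMeasure_real {E : Set X} (hE : MeasurableSet E) :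
    (F.traceMeasure.real E : ℂ) = (F.toVec E).trace := by
  have h := Complex.le_def.1 (F.posSemidef E hE).trace_nonneg
  rw [measureReal_def, F.traceMeasure_apply hE, ENNReal.toReal_ofReal h.1]
  exact Complex.ext (by simp) (by simpa using h.2)

theorem traceMeasure_real_univ : F.traceMeasure.real Set.univ = Fintype.card n := by
  have h := F.traceMeasure_real MeasurableSet.univ
  rw [F.map_univ, Matrix.trace_one] at h
  exact_mod_cast h

theorem entry_apply (i j : n) (E : Set X) : F.entry i j E = F.toVec E i j := rfl

/-- A positive semidefinite matrix of trace zero vanishes, so a `τ`-null set is null for every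
entry. -/
theorem entry_absolutelyContinuous (i j : n) :
    F.entry i j ≪ᵥ F.traceMeasure.toENNRealVectorMeasure := by
  refine VectorMeasure.AbsolutelyContinuous.mk fun E hE h => ?_
  rw [Measure.toENNRealVectorMeasure_apply_measurable hE] at h
  have h0 : (F.toVec E).trace = 0 := by rw [← F.traceMeasure_real hE, measureReal_def, h]; simp
  rw [F.entry_apply, (F.posSemidef E hE).trace_eq_zero_iff.1 h0, Matrix.zero_apply]

theorem integrable_density (i j : n) : Integrable (fun x => F.density x i j) F.traceMeasure :=
  ComplexMeasure.integrable_rnDeriv _ _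

theorem setIntegral_density (i j : n) {E : Set X} (hE : MeasurableSet E) :
    ∫ x in E, F.density x i j ∂F.traceMeasure = F.toVec E i j := by
  have hac := (ComplexMeasure.absolutelyContinuous_ennreal_iff _ _).1
    (F.entry_absolutelyContinuous i j)
  have hi : Integrable ((F.entry i j).rnDeriv F.traceMeasure) (F.traceMeasure.restrict E) :=
    (ComplexMeasure.integrable_rnDeriv _ _).integrableOn
  change ∫ x in E, (F.entry i j).rnDeriv F.traceMeasure x ∂F.traceMeasure = F.entry i j E
  refine Complex.ext ?_ ?_
  · rw [← RCLike.re_eq_complex_re, ← integral_re hi]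
    have h := congrArg (fun v => v E) (SignedMeasure.withDensityᵥ_rnDeriv_eq _ _ hac.1)
    rwa [withDensityᵥ_apply (SignedMeasure.integrable_rnDeriv _ _) hE] at h
  · rw [← RCLike.im_eq_complex_im, ← integral_im hi]
    have h := congrArg (fun v => v E) (SignedMeasure.withDensityᵥ_rnDeriv_eq _ _ hac.2)
    rwa [withDensityᵥ_apply (SignedMeasure.integrable_rnDeriv _ _) hE] at h

theorem integral_density (i j : n) :
    ∫ x, F.density x i j ∂F.traceMeasure = (1 : Matrix n n ℂ) i j := by
  rw [← setIntegral_univ, F.setIntegral_density i j MeasurableSet.univ, F.map_univ]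

theorem integral_star_density (i j : n) :
    ∫ x, star (F.density x i j) ∂F.traceMeasure = (1 : Matrix n n ℂ) i j := by
  have := (integral_conj (μ := F.traceMeasure) (f := fun x => F.density x i j))
  rw [F.integral_density] at this
  refine this.trans ?_
  rw [Matrix.one_apply]
  split_ifs <;> simp

/-- Integrable functions with equal integrals over all measurable sets agree almost everywhere, so
linear identities satisfied by every `F(E)` pass to the density. -/
theorem isHermitian_density : ∀ᵐ x ∂F.traceMeasure, (F.density x).IsHermitian := by
  have h : ∀ i j, ∀ᵐ x ∂F.traceMeasure, star (F.density x j i) = F.density x i j := fun i j => by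
    refine Integrable.ae_eq_of_forall_setIntegral_eq _ _
      (Complex.conjLIE.toContinuousLinearEquiv.toContinuousLinearMap.integrable_comp
        (F.integrable_density j i)) (F.integrable_density i j) fun E hE _ => ?_
    refine (integral_conj (μ := F.traceMeasure.restrict E) (f := fun x => F.density x j i)).trans ?_
    rw [F.setIntegral_density _ _ hE, F.setIntegral_density _ _ hE]
    exact (F.posSemidef E hE).isHermitian.apply i j
  have h' := ae_all_iff.2 fun i => ae_all_iff.2 (h i)
  filter_upwards [h'] with x hx
  exact Matrix.IsHermitian.ext hx

theorem trace_density : ∀ᵐ x ∂F.traceMeasure, (F.density x).trace = 1 := by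
  have hi : Integrable (fun x => (F.density x).trace) F.traceMeasure :=
    integrable_finsetSum _ fun i _ => F.integrable_density i i
  refine Integrable.ae_eq_of_forall_setIntegral_eq _ _ hi (integrable_const 1) fun E hE _ => ?_
  have : ∫ x in E, (F.density x).trace ∂F.traceMeasure = (F.toVec E).trace := by
    simp only [Matrix.trace, Matrix.diag]
    rw [integral_finsetSum _ fun i _ => (F.integrable_density i i).integrableOn]
    exact Finset.sum_congr rfl fun i _ => F.setIntegral_density i i hE
  rw [this, ← F.traceMeasure_real hE]
  simp

theorem IsRankOne.isPureState {F : POVM X n} (h : F.IsRankOne) :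
    ∀ᵐ x ∂F.traceMeasure, IsPureState (F.density x) := by
  filter_upwards [h, F.isHermitian_density, F.trace_density] with x h1 h2 h3
  exact isPureState_of_rank_eq_one h1 h2 h3

end POVM

/-! ### Superoperators -/

theorem opKet_injective {n : Type*} : Function.Injective (opKet : Matrix n n ℂ → n × n → ℂ) :=
    fun A B h => by
  ext i j
  exact congrFun h (i, j)

section Superoperators

variable {n : Type*} [Fintype n]

theorem star_opKet_dotProduct (A B : Matrix n n ℂ) :
    star (opKet A) ⬝ᵥ opKet B = (Aᴴ * B).trace := by
  rw [Matrix.trace, dotProduct, Fintype.sum_prod_type_right]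
  exact Finset.sum_congr rfl fun i _ => by
    simp [Matrix.mul_apply, opKet]

theorem opKet_act (S : Superop n) (A : Matrix n n ℂ) : opKet (S.act A) = S *ᵥ opKet A := rfl

theorem act_opKetBra (A B C : Matrix n n ℂ) :
    Superop.act (opKetBra A B) C = (Bᴴ * C).trace • A := by
  refine opKet_injective ?_
  rw [opKet_act, opKetBra, Matrix.vecMulVec_mulVec, star_opKet_dotProduct]
  ext p
  simp [opKet, mul_comm]

theorem act_mul (S T : Superop n) (A : Matrix n n ℂ) :
    Superop.act (S * T) A = S.act (T.act A) := by
  refine opKet_injective ?_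
  rw [opKet_act, opKet_act, opKet_act, Matrix.mulVec_mulVec]

theorem act_sub (S T : Superop n) (A : Matrix n n ℂ) :
    Superop.act (S - T) A = S.act A - T.act A := by
  refine opKet_injective ?_
  rw [opKet_act, Matrix.sub_mulVec]
  rfl

theorem act_smul (c : ℂ) (S : Superop n) (A : Matrix n n ℂ) :
    Superop.act (c • S) A = c • S.act A := by
  refine opKet_injective ?_
  rw [opKet_act, Matrix.smul_mulVec]
  rfl

theorem act_smul_right (S : Superop n) (c : ℂ) (A : Matrix n n ℂ) :
    S.act (c • A) = c • S.act A := by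
  refine opKet_injective ?_
  rw [opKet_act, show opKet (c • A) = c • opKet A from rfl, Matrix.mulVec_smul]
  rfl

/-- Every matrix is a complex combination of two Hermitian ones, and the action is complex linear.
-/
theorem superop_ext {S T : Superop n}
    (h : ∀ A : Matrix n n ℂ, A.IsHermitian → S.act A = T.act A) : S = T := by
  classical
  have hall : ∀ A, S.act A = T.act A := fun A => by
    have h1 : (A + Aᴴ).IsHermitian := by
      rw [Matrix.IsHermitian, Matrix.conjTranspose_add, Matrix.conjTranspose_conjTranspose,
        add_comm]
    have h2 : (Complex.I • (A - Aᴴ)).IsHermitian := by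
      rw [Matrix.IsHermitian, Matrix.conjTranspose_smul, Matrix.conjTranspose_sub,
        Matrix.conjTranspose_conjTranspose, ← neg_sub A, smul_neg]
      simp
    have hA : A = (2⁻¹ : ℂ) • (A + Aᴴ) - (2⁻¹ * Complex.I) • Complex.I • (A - Aᴴ) := by
      rw [smul_smul, mul_assoc, Complex.I_mul_I]
      module
    rw [hA, map_sub, map_sub, act_smul_right S, act_smul_right S (2⁻¹ * Complex.I),
      act_smul_right T, act_smul_right T (2⁻¹ * Complex.I), h _ h1, h _ h2]
  refine Matrix.ext_of_mulVec_single fun p => ?_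
  have : Pi.single p 1 = opKet (Matrix.of fun i j => (Pi.single p 1 : n × n → ℂ) (i, j)) := rfl
  rw [this, ← opKet_act, ← opKet_act, hall]

theorem mem_supp_iff {S : Superop n} {A : Matrix n n ℂ} :
    A ∈ S.supp ↔ ∃ B : Matrix n n ℂ, B.IsHermitian ∧ S.act B = A := Iff.rfl

end Superoperators

/-! ### The frame superoperator of a POVM with pure densities. -/

namespace POVM

variable {X : Type*} [MeasurableSpace X] {n : Type*} [Fintype n] [DecidableEq n] {F : POVM X n}

theorem frameOp_apply (p q : n × n) :
    F.frameOp p q = ∫ x, F.density x p.1 p.2 * star (F.density x q.1 q.2) ∂F.traceMeasure := rfl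

theorem integrable_density_mul_star (hp : ∀ᵐ x ∂F.traceMeasure, IsPureState (F.density x))
    (i j k l : n) :
    Integrable (fun x => F.density x i j * star (F.density x k l)) F.traceMeasure := by
  refine (F.integrable_density i j).mul_bdd (c := 1)
    (F.integrable_density k l).aestronglyMeasurable.star ?_
  filter_upwards [hp] with x hx
  simpa using hx.norm_apply_le k l

/-- Since `∫ P dτ = 1` and `τ(X) = n`, each of the two cross terms contributes `-1/n` and the square
term `n · 1/n²`, leaving one `-1/n`. -/
theorem frameOp₀_eq (hp : ∀ᵐ x ∂F.traceMeasure, IsPureState (F.density x))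
    (hn : Fintype.card n ≠ 0) :
    F.frameOp₀ = F.frameOp - ((Fintype.card n : ℂ)⁻¹) • opKetBra (1 : Matrix n n ℂ) 1 := by
  have hn' : (Fintype.card n : ℂ) ≠ 0 := by exact_mod_cast hn
  set N : ℂ := (Fintype.card n : ℂ) with hN
  have hNs : star N = N := by simp [hN]
  ext p q
  have h : ∀ x, (opKetBra (F.density₀ x) (F.density₀ x)) p q =
      F.density x p.1 p.2 * star (F.density x q.1 q.2)
        - N⁻¹ * (1 : Matrix n n ℂ) q.1 q.2 * F.density x p.1 p.2
        - N⁻¹ * (1 : Matrix n n ℂ) p.1 p.2 * star (F.density x q.1 q.2)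
        + N⁻¹ * N⁻¹ * (1 : Matrix n n ℂ) p.1 p.2 * (1 : Matrix n n ℂ) q.1 q.2 := fun x => by
    have h1 : star ((1 : Matrix n n ℂ) q.1 q.2) = (1 : Matrix n n ℂ) q.1 q.2 := by
      rw [Matrix.one_apply]; split_ifs <;> simp
    simp only [opKetBra, Matrix.vecMulVec_apply, opKet, density₀, Pi.star_apply, Matrix.sub_apply,
      Matrix.smul_apply, smul_eq_mul, star_sub, star_mul', star_inv₀, h1, hNs, ← hN]
    ring
  have hi1 := integrable_density_mul_star hp p.1 p.2 q.1 q.2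
  have hi2 := (F.integrable_density p.1 p.2).const_mul (N⁻¹ * (1 : Matrix n n ℂ) q.1 q.2)
  have hi3 : Integrable (fun x => N⁻¹ * (1 : Matrix n n ℂ) p.1 p.2 * star (F.density x q.1 q.2))
      F.traceMeasure :=
    (Complex.conjLIE.toContinuousLinearEquiv.toContinuousLinearMap.integrable_comp
      (F.integrable_density q.1 q.2)).const_mul _
  have hi12 : Integrable (fun x => F.density x p.1 p.2 * star (F.density x q.1 q.2)
      - N⁻¹ * (1 : Matrix n n ℂ) q.1 q.2 * F.density x p.1 p.2) F.traceMeasure := hi1.sub hi2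
  have hi123 : Integrable (fun x => F.density x p.1 p.2 * star (F.density x q.1 q.2)
      - N⁻¹ * (1 : Matrix n n ℂ) q.1 q.2 * F.density x p.1 p.2
      - N⁻¹ * (1 : Matrix n n ℂ) p.1 p.2 * star (F.density x q.1 q.2)) F.traceMeasure :=
    hi12.sub hi3
  have hp' : F.frameOp₀ p q = ∫ x, (opKetBra (F.density₀ x) (F.density₀ x)) p q ∂F.traceMeasure :=
    rfl
  rw [hp', integral_congr_ae (ae_of_all _ h)]
  rw [integral_add hi123 (integrable_const _), integral_sub hi12 hi3,
    integral_sub hi1 hi2, integral_const_mul, integral_const_mul, F.integral_density,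
    F.integral_star_density, integral_const, F.traceMeasure_real_univ, Matrix.sub_apply,
    frameOp_apply, Matrix.smul_apply, opKetBra, Matrix.vecMulVec_apply]
  have h1 : star (opKet (1 : Matrix n n ℂ)) q = (1 : Matrix n n ℂ) q.1 q.2 := by
    rw [Pi.star_apply, opKet, Matrix.one_apply]; split_ifs <;> simp
  rw [h1, Complex.real_smul, Complex.ofReal_natCast, ← hN, smul_eq_mul]
  simp only [opKet]
  field_simp
  ring

theorem act_frameOp_apply (hp : ∀ᵐ x ∂F.traceMeasure, IsPureState (F.density x))
    (A : Matrix n n ℂ) (i j : n) :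
    F.frameOp.act A i j = ∫ x, F.density x i j * ((F.density x)ᴴ * A).trace ∂F.traceMeasure := by
  simp only [← star_opKet_dotProduct, dotProduct, Finset.mul_sum]
  rw [integral_finsetSum]
  · change ∑ q, F.frameOp (i, j) q * opKet A q = _
    refine Finset.sum_congr rfl fun q _ => ?_
    rw [frameOp_apply, ← integral_mul_const]
    simp only [mul_assoc]
    rfl
  · intro q _
    simp only [← mul_assoc]
    exact (integrable_density_mul_star hp i j q.1 q.2).mul_const _

theorem integrable_density_mul_trace (hp : ∀ᵐ x ∂F.traceMeasure, IsPureState (F.density x))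
    (A : Matrix n n ℂ) (i j : n) :
    Integrable (fun x => F.density x i j * ((F.density x)ᴴ * A).trace) F.traceMeasure := by
  simp only [← star_opKet_dotProduct, dotProduct, Finset.mul_sum]
  refine integrable_finsetSum _ fun q _ => ?_
  simp only [← mul_assoc]
  exact (integrable_density_mul_star hp i j q.1 q.2).mul_const _

/-- The factor `tr P = 1` drops out under the trace, and `∫ P dτ = 1` does the rest. -/
theorem trace_act_frameOp (hp : ∀ᵐ x ∂F.traceMeasure, IsPureState (F.density x))
    (A : Matrix n n ℂ) : (F.frameOp.act A).trace = A.trace := by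
  have h0 : (F.frameOp.act A).trace =
      ∑ i, ∫ x, F.density x i i * ((F.density x)ᴴ * A).trace ∂F.traceMeasure :=
    Finset.sum_congr rfl fun i _ => act_frameOp_apply hp A i i
  rw [h0, ← integral_finsetSum _ fun i _ => integrable_density_mul_trace hp A i i]
  have h : (fun x => ∑ i, F.density x i i * ((F.density x)ᴴ * A).trace) =ᵐ[F.traceMeasure]
      fun x => ∑ q : n × n, star (F.density x q.1 q.2) * A q.1 q.2 := by
    filter_upwards [F.trace_density] with x hx
    rw [← Finset.sum_mul, show ∑ i, F.density x i i = 1 from hx, one_mul, ← star_opKet_dotProduct]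
    rfl
  rw [integral_congr_ae h, integral_finsetSum]
  · simp_rw [integral_mul_const, F.integral_star_density]
    rw [Fintype.sum_prod_type]
    simp [Matrix.one_apply, Matrix.trace]
  · intro q _
    exact (Complex.conjLIE.toContinuousLinearEquiv.toContinuousLinearMap.integrable_comp
        (F.integrable_density q.1 q.2)).mul_const _

/-- The hypothesis is the vanishing of `∫ |tr(P† A)|² dτ`, an integral of a nonnegative function. -/
theorem trace_density_mul_eq_zero (hp : ∀ᵐ x ∂F.traceMeasure, IsPureState (F.density x))
    {A : Matrix n n ℂ} (hA : (Aᴴ * F.frameOp.act A).trace = 0) :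
    ∀ᵐ x ∂F.traceMeasure, ((F.density x)ᴴ * A).trace = 0 := by
  have hpt : ∀ x, ∑ q : n × n, star (A q.1 q.2) *
      (F.density x q.1 q.2 * ((F.density x)ᴴ * A).trace) =
      ((‖((F.density x)ᴴ * A).trace‖ ^ 2 : ℝ) : ℂ) := fun x => by
    simp only [← mul_assoc]
    rw [← Finset.sum_mul, Complex.ofReal_pow, ← Complex.conj_mul']
    congr 1
    rw [← star_opKet_dotProduct, dotProduct, map_sum]
    refine Finset.sum_congr rfl fun q _ => ?_
    simp [opKet, mul_comm]
  have hint : Integrable (fun x => ((‖((F.density x)ᴴ * A).trace‖ ^ 2 : ℝ) : ℂ))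
      F.traceMeasure := by
    simp only [← hpt]
    exact integrable_finsetSum _ fun q _ => (integrable_density_mul_trace hp A q.1 q.2).const_mul _
  have h0 : ∫ x, ((‖((F.density x)ᴴ * A).trace‖ ^ 2 : ℝ) : ℂ) ∂F.traceMeasure = 0 := by
    simp only [← hpt]
    rw [integral_finsetSum _ fun q _ => (integrable_density_mul_trace hp A q.1 q.2).const_mul _,
      ← hA, ← star_opKet_dotProduct, dotProduct]
    refine Finset.sum_congr rfl fun q _ => ?_
    rw [integral_const_mul, ← act_frameOp_apply hp]
    rfl
  have hint' : Integrable (fun x => ‖((F.density x)ᴴ * A).trace‖ ^ 2) F.traceMeasure := by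
    simpa only [Complex.reCLM_apply, Complex.ofReal_re] using Complex.reCLM.integrable_comp hint
  rw [integral_complex_ofReal, Complex.ofReal_eq_zero,
    integral_eq_zero_iff_of_nonneg (fun x => by positivity) hint'] at h0
  filter_upwards [h0] with x hx
  simpa using hx

end POVM

/-! ### Unital states and maximally entangled states -/

section Unital

variable {d : ℕ}

theorem trace_mul_kronecker_one (A : Matrix (I2 d) (I2 d) ℂ) (B : Matrix (Fin d) (Fin d) ℂ) :
    (A * (B ⊗ₖ (1 : Matrix (Fin d) (Fin d) ℂ))).trace = (trA A * B).trace := by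
  simp only [Matrix.trace, Matrix.diag, Matrix.mul_apply, Matrix.kroneckerMap_apply, trA,
    Matrix.of_apply, Fintype.sum_prod_type, Matrix.one_apply, mul_ite, mul_one, mul_zero,
    Finset.sum_ite_eq', Finset.mem_univ, if_true, Finset.sum_mul]
  exact Finset.sum_congr rfl fun i _ => Finset.sum_comm

theorem trace_trA (A : Matrix (I2 d) (I2 d) ℂ) : (trA A).trace = A.trace := by
  simp [Matrix.trace, trA, Fintype.sum_prod_type]

/-- With `A = u wᵀ`, Hermitian idempotence gives `A = A A† = ‖w‖² u u†`; the scalar is absorbed into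
`u` through its square root. -/
theorem exists_vecMulVec_of_isPureState {n : Type*} [Fintype n] [DecidableEq n]
    {A : Matrix n n ℂ} (h1 : A.rank = 1) (hA : IsPureState A) :
    ∃ v : n → ℂ, A = Matrix.vecMulVec v (star v) := by
  obtain ⟨u, w, hu⟩ := exists_eq_vecMulVec_of_rank_eq_one h1
  have hc : w ⬝ᵥ star w = (((∑ i, ‖w i‖ ^ 2 : ℝ)) : ℂ) := by
    rw [dotProduct, Complex.ofReal_sum]
    exact Finset.sum_congr rfl fun i _ => by
      rw [Complex.ofReal_pow, ← Complex.mul_conj']; rfl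
  have hA' : A = (w ⬝ᵥ star w) • Matrix.vecMulVec u (star u) := by
    conv_lhs => rw [← hA.2.1]; arg 2; rw [← hA.1]
    rw [hu, Matrix.conjTranspose_vecMulVec, Matrix.vecMulVec_mul_vecMulVec]
    ext i j
    simp [Matrix.vecMulVec_apply, mul_left_comm]
  refine ⟨((Real.sqrt (∑ i, ‖w i‖ ^ 2) : ℝ) : ℂ) • u, ?_⟩
  rw [hA', hc]
  conv_lhs => rw [← Real.mul_self_sqrt (show 0 ≤ ∑ i, ‖w i‖ ^ 2 by positivity)]
  ext i j
  simp only [Matrix.smul_apply, Matrix.vecMulVec_apply, Pi.smul_apply, Pi.star_apply, smul_eq_mul,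
    star_mul', Complex.ofReal_mul, Complex.star_def, Complex.conj_ofReal]
  ring

theorem star_unitaryKet_dotProduct (hd : 0 < d) (V : U d) :
    star (unitaryKet V) ⬝ᵥ unitaryKet V = 1 := by
  have hV : ((V : Matrix (Fin d) (Fin d) ℂ)ᴴ * V) = 1 := Matrix.mem_unitaryGroup_iff'.1 V.2
  have hs : ((Real.sqrt d : ℝ) : ℂ) * ((Real.sqrt d : ℝ) : ℂ) = d := by
    rw [← Complex.ofReal_mul, Real.mul_self_sqrt (by positivity)]; simp
  have hd' : (d : ℂ) ≠ 0 := by exact_mod_cast hd.ne'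
  have h1 : star (unitaryKet V) ⬝ᵥ unitaryKet V =
      (d : ℂ)⁻¹ * ((V : Matrix (Fin d) (Fin d) ℂ)ᴴ * V).trace := by
    rw [← star_opKet_dotProduct, dotProduct, dotProduct, Finset.mul_sum]
    refine Finset.sum_congr rfl fun p _ => ?_
    simp only [unitaryKet, opKet, Pi.star_apply, star_mul', star_inv₀, Complex.star_def,
      Complex.conj_ofReal, ← hs, mul_inv]
    ring
  rw [h1, hV, Matrix.trace_one, Fintype.card_fin, inv_mul_cancel₀ hd']

theorem isPureState_unitaryState (hd : 0 < d) (V : U d) : IsPureState (unitaryState V) :=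
  isPureState_vecMulVec (star_unitaryKet_dotProduct hd V)

theorem rank_unitaryState (hd : 0 < d) (V : U d) : (unitaryState V).rank = 1 :=
  rank_vecMulVec_eq_one (star_unitaryKet_dotProduct hd V)

theorem unitaryState_apply (V : U d) (p q : I2 d) : unitaryState V p q =
    (d : ℂ)⁻¹ * ((V : Matrix (Fin d) (Fin d) ℂ) p.1 p.2
      * star ((V : Matrix (Fin d) (Fin d) ℂ) q.1 q.2)) := by
  have hs : ((Real.sqrt d : ℝ) : ℂ) * ((Real.sqrt d : ℝ) : ℂ) = d := by
    rw [← Complex.ofReal_mul, Real.mul_self_sqrt (by positivity)]; simp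
  simp only [unitaryState, Matrix.vecMulVec_apply, unitaryKet, Pi.star_apply, star_mul', star_inv₀,
      Complex.star_def, Complex.conj_ofReal, ← hs, mul_inv]
  ring

/-- Reshaping `√d v` into a square matrix `W` turns the marginal into `W W† = d trA(v v†) = 1`.
One-sided unitarity suffices for square matrices, so the other marginal is not needed. -/
theorem exists_unitaryState_of_trA {v : I2 d → ℂ} (hd : 0 < d)
    (hv : trA (Matrix.vecMulVec v (star v)) = (d : ℂ)⁻¹ • 1) :
    ∃ V : U d, Matrix.vecMulVec v (star v) = unitaryState V := by
  have hd' : (d : ℂ) ≠ 0 := by exact_mod_cast hd.ne'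
  have hs : ((Real.sqrt d : ℝ) : ℂ) * ((Real.sqrt d : ℝ) : ℂ) = d := by
    rw [← Complex.ofReal_mul, Real.mul_self_sqrt (by positivity)]; simp
  have hs0 : ((Real.sqrt d : ℝ) : ℂ) ≠ 0 := fun h => hd' (by rw [← hs, h, mul_zero])
  let W : Matrix (Fin d) (Fin d) ℂ := Matrix.of fun i a => ((Real.sqrt d : ℝ) : ℂ) * v (i, a)
  have hW : W ∈ Matrix.unitaryGroup (Fin d) ℂ := by
    rw [Matrix.mem_unitaryGroup_iff]
    have h : W * star W = (d : ℂ) • trA (Matrix.vecMulVec v (star v)) := by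
      ext i j
      simp only [Matrix.mul_apply, W, Matrix.star_apply, Matrix.of_apply, star_mul',
        Complex.star_def, Complex.conj_ofReal, Matrix.smul_apply, trA, Matrix.vecMulVec_apply,
        smul_eq_mul, Finset.mul_sum, ← hs, Pi.star_apply]
      exact Finset.sum_congr rfl fun k _ => by ring
    rw [h, hv, smul_smul, mul_inv_cancel₀ hd', one_smul]
  refine ⟨⟨W, hW⟩, ?_⟩
  have : unitaryKet ⟨W, hW⟩ = v := by
    ext p
    simp only [unitaryKet, W, Matrix.of_apply]
    rw [inv_mul_cancel_left₀ hs0]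
  rw [unitaryState, this]

theorem trace_conjTranspose_mul_of_mem_span {A C : Matrix (I2 d) (I2 d) ℂ}
    (hC : ∀ ρ ∈ Quc d, (ρᴴ * C).trace = 0) (hA : A ∈ Submodule.span ℝ (Quc d)) :
    (Aᴴ * C).trace = 0 := by
  induction hA using Submodule.span_induction with
  | mem ρ h => exact hC ρ h
  | zero => simp
  | add A B _ _ hA hB =>
    rw [Matrix.conjTranspose_add, Matrix.add_mul, Matrix.trace_add, hA, hB, add_zero]
  | smul r A _ hA => rw [Matrix.conjTranspose_smul, Matrix.smul_mul, Matrix.trace_smul, hA, smul_zero]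

end Unital

/-! ### The support hypothesis forces maximally entangled densities. -/

namespace POVM

variable {X : Type*} [MeasurableSpace X] {d : ℕ} {F : POVM X (I2 d)}

theorem trace_density_mul_eq_zero_of_isHermitian
    (hp : ∀ᵐ x ∂F.traceMeasure, IsPureState (F.density x))
    (hF : F.frameOp.supp = Submodule.span ℝ (Quc d)) {C : Matrix (I2 d) (I2 d) ℂ}
    (hC : C.IsHermitian) (h : ∀ ρ ∈ Quc d, (ρᴴ * C).trace = 0) :
    ∀ᵐ x ∂F.traceMeasure, ((F.density x)ᴴ * C).trace = 0 := by
  refine trace_density_mul_eq_zero hp ?_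
  have hm : F.frameOp.act C ∈ Submodule.span ℝ (Quc d) := hF ▸ mem_supp_iff.2 ⟨C, hC, rfl⟩
  have h0 := trace_conjTranspose_mul_of_mem_span h hm
  rw [← star_eq_zero, ← Matrix.trace_conjTranspose, Matrix.conjTranspose_mul,
    Matrix.conjTranspose_conjTranspose] at h0
  exact h0

/-- Splitting `C` into Hermitian and anti-Hermitian parts reduces to the Hermitian case, the only
one the support, an image of Hermitian operators, can control. -/
theorem trace_density_mul_eq_zero_of_forall
    (hp : ∀ᵐ x ∂F.traceMeasure, IsPureState (F.density x))
    (hF : F.frameOp.supp = Submodule.span ℝ (Quc d)) {C : Matrix (I2 d) (I2 d) ℂ}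
    (h : ∀ ρ ∈ Quc d, (ρ * C).trace = 0) :
    ∀ᵐ x ∂F.traceMeasure, (F.density x * C).trace = 0 := by
  have h1 : (C + Cᴴ).IsHermitian := by
    rw [Matrix.IsHermitian, Matrix.conjTranspose_add, Matrix.conjTranspose_conjTranspose, add_comm]
  have h2 : (Complex.I • (C - Cᴴ)).IsHermitian := by
    rw [Matrix.IsHermitian, Matrix.conjTranspose_smul, Matrix.conjTranspose_sub,
      Matrix.conjTranspose_conjTranspose, ← neg_sub C, smul_neg]
    simp
  have h' : ∀ ρ ∈ Quc d, (ρ * Cᴴ).trace = 0 := fun ρ hρ => by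
    rw [← hρ.1.isHermitian, ← Matrix.conjTranspose_mul, Matrix.trace_conjTranspose,
      Matrix.trace_mul_comm, h ρ hρ, star_zero]
  have e1 := trace_density_mul_eq_zero_of_isHermitian hp hF h1 fun ρ hρ => by
    rw [hρ.1.isHermitian, Matrix.mul_add, Matrix.trace_add, h ρ hρ, h' ρ hρ, add_zero]
  have e2 := trace_density_mul_eq_zero_of_isHermitian hp hF h2 fun ρ hρ => by
    rw [hρ.1.isHermitian, Matrix.mul_smul, Matrix.mul_sub, Matrix.trace_smul, Matrix.trace_sub,
      h ρ hρ, h' ρ hρ, sub_zero, smul_zero]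
  filter_upwards [e1, e2, hp] with x a1 a2 hx
  rw [hx.1, Matrix.mul_add, Matrix.trace_add] at a1
  rw [hx.1, Matrix.mul_smul, Matrix.mul_sub, Matrix.trace_smul, Matrix.trace_sub, smul_eq_mul,
    mul_eq_zero, or_iff_right Complex.I_ne_zero] at a2
  linear_combination (a1 + a2) / 2

theorem trA_density (hp : ∀ᵐ x ∂F.traceMeasure, IsPureState (F.density x))
    (hF : F.frameOp.supp = Submodule.span ℝ (Quc d)) (hd : 0 < d) :
    ∀ᵐ x ∂F.traceMeasure, trA (F.density x) = (d : ℂ)⁻¹ • 1 := by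
  have hd' : (d : ℂ) ≠ 0 := by exact_mod_cast hd.ne'
  have h : ∀ B : Matrix (Fin d) (Fin d) ℂ, B.trace = 0 →
      ∀ᵐ x ∂F.traceMeasure, (trA (F.density x) * B).trace = 0 := fun B hB => by
    simp only [← trace_mul_kronecker_one]
    refine trace_density_mul_eq_zero_of_forall hp hF fun ρ hρ => ?_
    rw [trace_mul_kronecker_one, hρ.2.2.2, Matrix.smul_mul, Matrix.one_mul, Matrix.trace_smul, hB,
      smul_zero]
  -- The traceless part of the matrix unit `E_{ji}` tests the entry `(i, j)` of `trA P` against that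
  -- of `I/d`; finitely many tests share one null set.
  have hij := ae_all_iff.2 fun i => ae_all_iff.2 fun j =>
    h (Matrix.single j i 1 - ((d : ℂ)⁻¹ * if j = i then 1 else 0) • 1) (by
      rw [Matrix.trace_sub, Matrix.trace_smul, Matrix.trace_one, Fintype.card_fin]
      by_cases hji : j = i
      · subst hji; simp [hd']
      · simp [hji, Matrix.trace_single_eq_of_ne])
  filter_upwards [hij, hp] with x hx hpx
  ext i j
  have h1 := hx i j
  rw [Matrix.mul_sub, Matrix.mul_smul, Matrix.mul_one, Matrix.trace_sub, Matrix.trace_smul,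
    trace_trA, hpx.2.2, Matrix.trace_mul_single, sub_eq_zero] at h1
  simp only [MulOpposite.op_one, one_smul, smul_eq_mul, mul_one] at h1
  rw [h1, Matrix.smul_apply, Matrix.one_apply, smul_eq_mul]
  simp only [eq_comm]

theorem exists_hasUnitaryDensity (hr : F.IsRankOne)
    (hF : F.frameOp.supp = Submodule.span ℝ (Quc d)) (hd : 0 < d) :
    ∃ V : X → U d, F.HasUnitaryDensity V := by
  have h : ∀ᵐ x ∂F.traceMeasure, ∃ V : U d, F.density x = unitaryState V := by
    filter_upwards [hr, hr.isPureState, trA_density hr.isPureState hF hd] with x h1 h2 h3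
    obtain ⟨v, hv⟩ := exists_vecMulVec_of_isPureState h1 h2
    rw [hv] at h3 ⊢
    exact exists_unitaryState_of_trA hd h3
  classical
  refine ⟨fun x => if hx : ∃ V : U d, F.density x = unitaryState V then hx.choose else 1, ?_⟩
  filter_upwards [h] with x hx
  rw [dif_pos hx]
  exact hx.choose_spec

theorem HasUnitaryDensity.isPureState {V : X → U d} (h : F.HasUnitaryDensity V) (hd : 0 < d) :
    ∀ᵐ x ∂F.traceMeasure, IsPureState (F.density x) := by
  filter_upwards [h] with x hx
  rw [hx]
  exact isPureState_unitaryState hd _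

theorem HasUnitaryDensity.isRankOne {V : X → U d} (h : F.HasUnitaryDensity V) (hd : 0 < d) :
    F.IsRankOne := by
  filter_upwards [h] with x hx
  rw [hx]
  exact rank_unitaryState hd _

end POVM

/-! ### The projector onto operators with vanishing partial traces -/

/-- The orthogonal projector onto the traceless operators. -/
def tracelessProj (d : ℕ) : Superop (Fin d) :=
  1 - (d : ℂ)⁻¹ • opKetBra (1 : Matrix (Fin d) (Fin d) ℂ) 1

/-- The orthogonal projector onto the operators with vanishing partial traces. -/
def marginalFreeProj (d : ℕ) : Superop (I2 d) :=
  (tracelessProj d ⊗ₖ tracelessProj d).submatrix (Equiv.prodProdProdComm _ _ _ _)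
    (Equiv.prodProdProdComm _ _ _ _)

section Projector

variable {d : ℕ}

theorem isStarProjection_tracelessProj (hd : 0 < d) : IsStarProjection (tracelessProj d) := by
  have hd' : (d : ℂ) ≠ 0 := by exact_mod_cast hd.ne'
  have h : IsStarProjection
      ((d : ℂ)⁻¹ • opKetBra (1 : Matrix (Fin d) (Fin d) ℂ) 1 : Superop (Fin d)) := by
    refine ⟨?_, ?_⟩
    · rw [IsIdempotentElem, Matrix.smul_mul, Matrix.mul_smul, opKetBra,
        Matrix.vecMulVec_mul_vecMulVec, star_opKet_dotProduct]
      ext p q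
      simp [hd']
    · rw [IsSelfAdjoint, star_smul, star_inv₀, Matrix.star_eq_conjTranspose, opKetBra,
        Matrix.conjTranspose_vecMulVec, star_star]
      simp
  exact h.one_sub

theorem isStarProjection_marginalFreeProj (hd : 0 < d) : IsStarProjection (marginalFreeProj d) := by
  have h := isStarProjection_tracelessProj hd
  refine ⟨?_, ?_⟩
  · rw [IsIdempotentElem, marginalFreeProj, Matrix.submatrix_mul_equiv, ← Matrix.mul_kronecker_mul,
      h.isIdempotentElem]
  · rw [IsSelfAdjoint, marginalFreeProj, Matrix.star_eq_conjTranspose,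
      Matrix.conjTranspose_submatrix, Matrix.conjTranspose_kronecker, ← Matrix.star_eq_conjTranspose,
      h.isSelfAdjoint]

theorem trace_marginalFreeProj (hd : 0 < d) :
    (marginalFreeProj d).trace = ((d : ℂ) ^ 2 - 1) ^ 2 := by
  have hd' : (d : ℂ) ≠ 0 := by exact_mod_cast hd.ne'
  have h : (tracelessProj d).trace = (d : ℂ) ^ 2 - 1 := by
    rw [tracelessProj, Matrix.trace_sub, Matrix.trace_smul, Matrix.trace_one, opKetBra,
      Matrix.trace_vecMulVec, dotProduct_comm, star_opKet_dotProduct]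
    simp [hd', sq]
  have h2 : (marginalFreeProj d).trace = (tracelessProj d ⊗ₖ tracelessProj d).trace :=
    Equiv.sum_comp (Equiv.prodProdProdComm _ _ _ _)
      fun p => (tracelessProj d ⊗ₖ tracelessProj d) p p
  rw [h2, Matrix.trace_kronecker, h, ← sq]

theorem tracelessProj_apply (i k j l : Fin d) : tracelessProj d (i, k) (j, l) =
    (1 : Matrix (Fin d) (Fin d) ℂ) i j * (1 : Matrix (Fin d) (Fin d) ℂ) k l
      - (d : ℂ)⁻¹ * ((1 : Matrix (Fin d) (Fin d) ℂ) i k * (1 : Matrix (Fin d) (Fin d) ℂ) j l) := by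
  have h : star (opKet (1 : Matrix (Fin d) (Fin d) ℂ)) (j, l) =
      (1 : Matrix (Fin d) (Fin d) ℂ) j l := by
    rw [Pi.star_apply, opKet, Matrix.one_apply]; split_ifs <;> simp
  rw [tracelessProj, Matrix.sub_apply, Matrix.smul_apply, opKetBra, Matrix.vecMulVec_apply, h,
    smul_eq_mul]
  simp only [opKet, Matrix.one_apply, Prod.mk.injEq]
  congr 1
  split_ifs <;> simp_all

theorem marginalFreeProj_apply (i a k c j b l e : Fin d) :
    marginalFreeProj d ((i, a), (k, c)) ((j, b), (l, e)) =
      tracelessProj d (i, k) (j, l) * tracelessProj d (a, c) (b, e) := rfl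

theorem act_marginalFreeProj (A : Matrix (I2 d) (I2 d) ℂ) :
    (marginalFreeProj d).act A = A - (d : ℂ)⁻¹ • (trA A ⊗ₖ (1 : Matrix (Fin d) (Fin d) ℂ))
      - (d : ℂ)⁻¹ • ((1 : Matrix (Fin d) (Fin d) ℂ) ⊗ₖ trS A)
      + ((d : ℂ)⁻¹ ^ 2 * A.trace) • 1 := by
  ext ⟨i, a⟩ ⟨k, c⟩
  change ∑ q, marginalFreeProj d ((i, a), (k, c)) q * opKet A q = _
  have h1 : ∀ q : (Fin d × Fin d) × (Fin d × Fin d),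
      marginalFreeProj d ((i, a), (k, c)) q * opKet A q =
      (if i = q.1.1 then if k = q.2.1 then if a = q.1.2 then if c = q.2.2 then A q.1 q.2
        else 0 else 0 else 0 else 0)
      - (d : ℂ)⁻¹ * (if a = c then 1 else 0) *
        (if i = q.1.1 then if k = q.2.1 then if q.1.2 = q.2.2 then A q.1 q.2 else 0 else 0 else 0)
      - (d : ℂ)⁻¹ * (if i = k then 1 else 0) *
        (if a = q.1.2 then if c = q.2.2 then if q.1.1 = q.2.1 then A q.1 q.2 else 0 else 0 else 0)
      + (d : ℂ)⁻¹ ^ 2 * (if i = k then 1 else 0) * (if a = c then 1 else 0) *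
        (if q.1.1 = q.2.1 then if q.1.2 = q.2.2 then A q.1 q.2 else 0 else 0) := by
    rintro ⟨⟨j, b⟩, ⟨l, e⟩⟩
    rw [marginalFreeProj_apply, tracelessProj_apply, tracelessProj_apply]
    simp only [Matrix.one_apply, opKet]
    split_ifs <;> ring
  simp only [h1, Finset.sum_add_distrib, Finset.sum_sub_distrib, ← Finset.mul_sum]
  simp only [Fintype.sum_prod_type, Matrix.add_apply, Matrix.sub_apply, Matrix.smul_apply,
    Matrix.kroneckerMap_apply, trA, trS, Matrix.of_apply, Matrix.one_apply, Matrix.trace,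
    Matrix.diag, smul_eq_mul, Prod.mk.injEq]
  simp only [Finset.sum_ite_irrel, Finset.sum_const_zero, Finset.sum_ite_eq, Finset.mem_univ,
    if_true]
  by_cases h2 : i = k <;> by_cases h3 : a = c <;> simp only [h2, h3, if_true, if_false, and_self,
    and_true, true_and] <;> ring

theorem trA_kronecker (B C : Matrix (Fin d) (Fin d) ℂ) : trA (B ⊗ₖ C) = C.trace • B := by
  ext i j
  simp [trA, Matrix.trace, ← Finset.mul_sum, mul_comm]

theorem trS_kronecker (B C : Matrix (Fin d) (Fin d) ℂ) : trS (B ⊗ₖ C) = B.trace • C := by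
  ext i j
  simp [trS, Matrix.trace, ← Finset.sum_mul]

theorem trA_add (A B : Matrix (I2 d) (I2 d) ℂ) : trA (A + B) = trA A + trA B := by
  ext i j
  simp [trA, Finset.sum_add_distrib]

theorem trS_add (A B : Matrix (I2 d) (I2 d) ℂ) : trS (A + B) = trS A + trS B := by
  ext i j
  simp [trS, Finset.sum_add_distrib]

theorem trA_smul (c : ℂ) (A : Matrix (I2 d) (I2 d) ℂ) : trA (c • A) = c • trA A := by
  ext i j
  simp [trA, Finset.mul_sum]

theorem trS_smul (c : ℂ) (A : Matrix (I2 d) (I2 d) ℂ) : trS (c • A) = c • trS A := by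
  ext i j
  simp [trS, Finset.mul_sum]

theorem trA_one : trA (1 : Matrix (I2 d) (I2 d) ℂ) = (d : ℂ) • 1 := by
  rw [← Matrix.one_kronecker_one, trA_kronecker, Matrix.trace_one, Fintype.card_fin]

theorem trS_one : trS (1 : Matrix (I2 d) (I2 d) ℂ) = (d : ℂ) • 1 := by
  rw [← Matrix.one_kronecker_one, trS_kronecker, Matrix.trace_one, Fintype.card_fin]

theorem trace_trS (A : Matrix (I2 d) (I2 d) ℂ) : (trS A).trace = A.trace := by
  simp [Matrix.trace, trS, Fintype.sum_prod_type_right]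

theorem conjTranspose_trA (A : Matrix (I2 d) (I2 d) ℂ) : (trA A)ᴴ = trA Aᴴ := by
  ext i j
  simp [trA]

theorem conjTranspose_trS (A : Matrix (I2 d) (I2 d) ℂ) : (trS A)ᴴ = trS Aᴴ := by
  ext i j
  simp [trS]

theorem trA_act_marginalFreeProj (hd : 0 < d) (A : Matrix (I2 d) (I2 d) ℂ) :
    trA ((marginalFreeProj d).act A) = 0 := by
  have hd' : (d : ℂ) ≠ 0 := by exact_mod_cast hd.ne'
  simp only [act_marginalFreeProj, sub_eq_add_neg, ← neg_smul, trA_add, trA_smul, trA_kronecker,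
    trA_one, trace_trS, Matrix.trace_one, Fintype.card_fin, smul_smul]
  match_scalars <;> field_simp <;> ring

theorem trS_act_marginalFreeProj (hd : 0 < d) (A : Matrix (I2 d) (I2 d) ℂ) :
    trS ((marginalFreeProj d).act A) = 0 := by
  have hd' : (d : ℂ) ≠ 0 := by exact_mod_cast hd.ne'
  simp only [act_marginalFreeProj, sub_eq_add_neg, ← neg_smul, trS_add, trS_smul, trS_kronecker,
    trS_one, trace_trA, Matrix.trace_one, Fintype.card_fin, smul_smul]
  match_scalars <;> field_simp <;> ring

theorem isHermitian_act_marginalFreeProj {A : Matrix (I2 d) (I2 d) ℂ} (hA : A.IsHermitian) :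
    ((marginalFreeProj d).act A).IsHermitian := by
  have ht : star A.trace = A.trace := by rw [← Matrix.trace_conjTranspose, hA]
  rw [Matrix.IsHermitian, act_marginalFreeProj]
  simp only [Matrix.conjTranspose_add, Matrix.conjTranspose_sub, Matrix.conjTranspose_smul,
    Matrix.conjTranspose_kronecker, conjTranspose_trA, conjTranspose_trS, Matrix.conjTranspose_one,
    hA.eq, star_mul', star_pow, star_inv₀, star_natCast, ht]

open scoped MatrixOrder Matrix.Norms.L2Operator in
-- The witness is `‖A‖ + 1`; the added one keeps it positive when `A = 0`.
theorem exists_posSemidef_smul_one_add {n : Type*} [Fintype n] [DecidableEq n] {A : Matrix n n ℂ}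
    (hA : A.IsHermitian) : ∃ r : ℝ, 0 < r ∧ ((r : ℂ) • 1 + A).PosSemidef := by
  have h : -(algebraMap ℝ (Matrix n n ℂ) ‖A‖) ≤ A :=
    IsSelfAdjoint.neg_algebraMap_norm_le_self hA
  rw [Matrix.le_iff, sub_neg_eq_add] at h
  refine ⟨‖A‖ + 1, by positivity, ?_⟩
  have he : ((‖A‖ + 1 : ℝ) : ℂ) • (1 : Matrix n n ℂ) + A = A + algebraMap ℝ (Matrix n n ℂ) ‖A‖ + 1 := by
    rw [Algebra.algebraMap_eq_smul_one, Complex.ofReal_add, add_smul, Complex.ofReal_one, one_smul,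
      Complex.coe_smul]
    abel
  rw [he]
  exact h.add Matrix.PosSemidef.one

/-- A small marginal-free perturbation of the maximally mixed state remains a unital state, so `A`
is a multiple of a difference of two elements of `𝒬^uc`. -/
theorem mem_span_Quc (hd : 0 < d) {A : Matrix (I2 d) (I2 d) ℂ} (hA : A.IsHermitian)
    (h1 : trA A = 0) (h2 : trS A = 0) : A ∈ Submodule.span ℝ (Quc d) := by
  have hd' : (d : ℂ) ≠ 0 := by exact_mod_cast hd.ne'
  obtain ⟨r, hr, hp⟩ := exists_posSemidef_smul_one_add hA
  have hr' : (r : ℂ) ≠ 0 := by exact_mod_cast hr.ne'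
  have hmem : ∀ B : Matrix (I2 d) (I2 d) ℂ, ((r : ℂ) • 1 + B).PosSemidef → trA B = 0 → trS B = 0 →
      ((r * (d : ℝ) ^ 2)⁻¹ : ℝ) • ((r : ℂ) • 1 + B) ∈ Quc d := fun B hB hB1 hB2 => by
    have ht : B.trace = 0 := by rw [← trace_trA, hB1, Matrix.trace_zero]
    rw [← Complex.coe_smul]
    refine ⟨hB.smul ?_, ?_, ?_, ?_⟩
    · rw [Complex.zero_le_real]; positivity
    · rw [Matrix.trace_smul, Matrix.trace_add, Matrix.trace_smul, ht, Matrix.trace_one]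
      simp
      field_simp
    · rw [trS_smul, trS_add, trS_smul, trS_one, hB2, add_zero, smul_smul, smul_smul]
      congr 1
      push_cast
      field_simp
    · rw [trA_smul, trA_add, trA_smul, trA_one, hB1, add_zero, smul_smul, smul_smul]
      congr 1
      push_cast
      field_simp
  have hAm := Submodule.subset_span (R := ℝ) (hmem A hp h1 h2)
  have h0m := Submodule.subset_span (R := ℝ) (hmem 0
    (by rw [add_zero]; exact Matrix.PosSemidef.one.smul (Complex.zero_le_real.2 hr.le))
    (by ext; simp [trA]) (by ext; simp [trS]))
  have h := Submodule.smul_mem _ (r * (d : ℝ) ^ 2) (Submodule.sub_mem _ hAm h0m)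
  rwa [← smul_sub, smul_smul, mul_inv_cancel₀ (by positivity), one_smul, add_zero,
    add_sub_cancel_left] at h

theorem act_marginalFreeProj_mem_span (hd : 0 < d) {A : Matrix (I2 d) (I2 d) ℂ}
    (hA : A.IsHermitian) : (marginalFreeProj d).act A ∈ Submodule.span ℝ (Quc d) :=
  mem_span_Quc hd (isHermitian_act_marginalFreeProj hA) (trA_act_marginalFreeProj hd A)
    (trS_act_marginalFreeProj hd A)

theorem trace_act_marginalFreeProj (hd : 0 < d) (A : Matrix (I2 d) (I2 d) ℂ) :
    ((marginalFreeProj d).act A).trace = 0 := by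
  rw [← trace_trA, trA_act_marginalFreeProj hd, Matrix.trace_zero]

/-- On a unital state the two marginal terms and the trace term combine to `-2/d² + 1/d² = -1/d²`;
linearity extends this to the span. -/
theorem act_marginalFreeProj_of_mem_span {A : Matrix (I2 d) (I2 d) ℂ}
    (hA : A ∈ Submodule.span ℝ (Quc d)) :
    (marginalFreeProj d).act A = A - ((d : ℂ)⁻¹ ^ 2 * A.trace) • 1 := by
  induction hA using Submodule.span_induction with
  | mem ρ h =>
    rw [act_marginalFreeProj, h.2.1, h.2.2.1, h.2.2.2, Matrix.smul_kronecker,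
      Matrix.kronecker_smul, Matrix.one_kronecker_one]
    module
  | zero => simp
  | add A B _ _ hA hB =>
    rw [map_add, hA, hB, Matrix.trace_add]
    module
  | smul r A _ hA =>
    rw [map_smul, hA, Matrix.trace_smul, smul_sub, Complex.real_smul, ← Complex.coe_smul r,
      ← Complex.coe_smul r, smul_smul]
    congr 2
    ring

end Projector

/-! ### Tightness as an explicit formula for the frame superoperator. -/

namespace POVM

variable {X : Type*} [MeasurableSpace X] {d : ℕ} {F : POVM X (I2 d)}

theorem trace_frameOp (hp : ∀ᵐ x ∂F.traceMeasure, IsPureState (F.density x)) :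
    F.frameOp.trace = (d : ℂ) ^ 2 := by
  simp only [Matrix.trace, Matrix.diag, frameOp_apply]
  rw [← integral_finsetSum _ fun p _ => integrable_density_mul_star hp p.1 p.2 p.1 p.2]
  have h : (fun x => ∑ p : I2 d × I2 d, F.density x p.1 p.2 * star (F.density x p.1 p.2))
      =ᵐ[F.traceMeasure] fun _ => 1 := by
    filter_upwards [hp] with x hx
    have h1 := star_opKet_dotProduct (F.density x) (F.density x)
    rw [hx.1, hx.2.1, hx.2.2] at h1
    rw [← h1, dotProduct]
    exact Finset.sum_congr rfl fun p _ => mul_comm _ _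
  rw [integral_congr_ae h, integral_const, F.traceMeasure_real_univ]
  simp [sq]

theorem frameOp₀_eq_sub (hp : ∀ᵐ x ∂F.traceMeasure, IsPureState (F.density x)) (hd : 0 < d) :
    F.frameOp₀ = F.frameOp - ((d : ℂ) ^ 2)⁻¹ • opKetBra (1 : Matrix (I2 d) (I2 d) ℂ) 1 := by
  have hd' : d ≠ 0 := hd.ne'
  rw [frameOp₀_eq hp (by simp [hd'])]
  simp [sq]

/-- A tight POVM of pure states whose frame superoperator is supported on the unital states. -/
theorem IsTight.frameOp₀_eq_smul (hp : ∀ᵐ x ∂F.traceMeasure, IsPureState (F.density x))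
    (hF : F.frameOp.supp = Submodule.span ℝ (Quc d)) (hd : 0 < d) (ht : F.IsTight) :
    ∃ a : ℂ, F.frameOp₀ = a • marginalFreeProj d := by
  obtain ⟨a, ha, Q, ⟨hQ, hs⟩, he⟩ := ht
  have hact : ∀ B, F.frameOp₀.act B = F.frameOp.act B - ((d : ℂ)⁻¹ ^ 2 * B.trace) • 1 := fun B => by
    rw [frameOp₀_eq_sub hp hd, act_sub, act_smul, act_opKetBra, Matrix.conjTranspose_one,
      Matrix.one_mul, smul_smul, inv_pow]
  -- `𝓕₀(B)` is an element of the span of `𝒬^uc` with its trace part removed, hence fixed by `Π`.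
  have hfix : ∀ A ∈ F.frameOp₀.supp, (marginalFreeProj d).act A = A := fun A hA => by
    obtain ⟨B, hB, rfl⟩ := mem_supp_iff.1 hA
    have hm : F.frameOp.act B ∈ Submodule.span ℝ (Quc d) := hF ▸ mem_supp_iff.2 ⟨B, hB, rfl⟩
    have h1 : (marginalFreeProj d).act 1 = 0 := by
      rw [act_marginalFreeProj, trA_one, trS_one, Matrix.smul_kronecker, Matrix.kronecker_smul,
        Matrix.one_kronecker_one, Matrix.trace_one]
      have hd' : (d : ℂ) ≠ 0 := by exact_mod_cast hd.ne'
      simp [smul_smul, hd', ← sq]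
    rw [hact, map_sub, act_smul_right, h1, smul_zero, sub_zero,
      act_marginalFreeProj_of_mem_span hm, trace_act_frameOp hp]
  -- Conversely `Π A` lies in the span, so it equals some `𝓕(B)`. Trace preservation gives `tr B =
  -- 0`, so `𝓕₀(B) = 𝓕(B)`.
  have hmem : ∀ A : Matrix (I2 d) (I2 d) ℂ, A.IsHermitian →
      (marginalFreeProj d).act A ∈ F.frameOp₀.supp := fun A hA => by
    have hm := act_marginalFreeProj_mem_span hd hA
    rw [← hF] at hm
    obtain ⟨B, hB, hBA⟩ := mem_supp_iff.1 hm
    refine mem_supp_iff.2 ⟨B, hB, ?_⟩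
    rw [hact, hBA, ← trace_act_frameOp hp B, hBA, trace_act_marginalFreeProj hd, mul_zero, zero_smul,
      sub_zero]
  have e1 : marginalFreeProj d * Q = Q := superop_ext fun A hA => by
    rw [act_mul]
    exact hfix _ (hs ▸ mem_supp_iff.2 ⟨A, hA, rfl⟩)
  have e2 : Q * marginalFreeProj d = marginalFreeProj d := superop_ext fun A hA => by
    obtain ⟨B, -, hBA⟩ := mem_supp_iff.1 (hs.symm ▸ hmem A hA)
    rw [act_mul, ← hBA, ← act_mul, hQ.isIdempotentElem]
  refine ⟨a, ?_⟩
  -- The adjoint of `Π Q = Q` is `Q Π = Q`; together with `Q Π = Π` this gives `Q = Π`.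
  have e3 := congrArg star e1
  rw [star_mul, hQ.isSelfAdjoint.star_eq, (isStarProjection_marginalFreeProj hd).isSelfAdjoint.star_eq,
    e2] at e3
  rw [he, ← e3]

/-- The frame superoperator of a tight rank-one POVM supported on the unital states. -/
theorem IsTight.frameOp_eq (hp : ∀ᵐ x ∂F.traceMeasure, IsPureState (F.density x))
    (hF : F.frameOp.supp = Submodule.span ℝ (Quc d)) (hd : 1 < d) (ht : F.IsTight) :
    F.frameOp = ((d : ℂ) ^ 2)⁻¹ • opKetBra (1 : Matrix (I2 d) (I2 d) ℂ) 1
      + ((d : ℂ) ^ 2 - 1)⁻¹ • marginalFreeProj d := by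
  have hd0 : 0 < d := zero_lt_one.trans hd
  obtain ⟨a, ha⟩ := ht.frameOp₀_eq_smul hp hF hd0
  have hd' : (d : ℂ) ≠ 0 := by exact_mod_cast hd0.ne'
  have h1 : (d : ℂ) ^ 2 - 1 ≠ 0 := by
    rw [sub_ne_zero]; exact_mod_cast (Nat.one_lt_pow two_ne_zero hd).ne'
  rw [frameOp₀_eq_sub hp hd0, sub_eq_iff_eq_add] at ha
  have h2 := congrArg Matrix.trace ha
  rw [trace_frameOp hp, Matrix.trace_add, Matrix.trace_smul, Matrix.trace_smul,
    trace_marginalFreeProj hd0, opKetBra, Matrix.trace_vecMulVec, dotProduct_comm,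
    star_opKet_dotProduct] at h2
  simp only [Matrix.conjTranspose_one, Matrix.one_mul, Matrix.trace_one, Fintype.card_prod,
    Fintype.card_fin, smul_eq_mul, Nat.cast_mul] at h2
  -- The trace identity is `d² = a (d² - 1)² + 1`; the factor `d² - 1` cancels because `d > 1`.
  have h3 : a = ((d : ℂ) ^ 2 - 1)⁻¹ := by
    rw [← sq, inv_mul_cancel₀ (pow_ne_zero 2 hd')] at h2
    refine eq_inv_of_mul_eq_one_left (mul_right_cancel₀ h1 ?_)
    linear_combination -h2
  rw [ha, h3, add_comm]

theorem isTight_of_frameOp_eq (hp : ∀ᵐ x ∂F.traceMeasure, IsPureState (F.density x)) (hd : 1 < d)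
    (h : F.frameOp = ((d : ℂ) ^ 2)⁻¹ • opKetBra (1 : Matrix (I2 d) (I2 d) ℂ) 1
      + ((d : ℂ) ^ 2 - 1)⁻¹ • marginalFreeProj d) : F.IsTight := by
  have hd0 : 0 < d := zero_lt_one.trans hd
  have hr : 0 < ((d : ℝ) ^ 2 - 1)⁻¹ := by
    rw [inv_pos, sub_pos]; exact_mod_cast Nat.one_lt_pow two_ne_zero hd
  have h₀ : F.frameOp₀ = ((((d : ℝ) ^ 2 - 1)⁻¹ : ℝ) : ℂ) • marginalFreeProj d := by
    rw [frameOp₀_eq_sub hp hd0, h, add_sub_cancel_left]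
    push_cast
    rfl
  refine ⟨_, hr, marginalFreeProj d, ⟨isStarProjection_marginalFreeProj hd0, ?_⟩, h₀⟩
  have hrc : ((((d : ℝ) ^ 2 - 1)⁻¹ : ℝ) : ℂ) ≠ 0 := by exact_mod_cast hr.ne'
  rw [h₀]
  ext A
  simp only [mem_supp_iff, act_smul]
  constructor
  · rintro ⟨B, hB, rfl⟩
    refine ⟨(((d : ℝ) ^ 2 - 1)⁻¹⁻¹ : ℝ) • B, ?_, ?_⟩
    · rw [Matrix.IsHermitian, Matrix.conjTranspose_smul, hB, star_trivial]
    · rw [← Complex.coe_smul, act_smul_right, smul_smul, ← Complex.ofReal_mul,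
        mul_inv_cancel₀ hr.ne', Complex.ofReal_one, one_smul]
  · rintro ⟨B, hB, rfl⟩
    refine ⟨(((d : ℝ) ^ 2 - 1)⁻¹ : ℝ) • B, ?_, ?_⟩
    · rw [Matrix.IsHermitian, Matrix.conjTranspose_smul, hB, star_trivial]
    · rw [← Complex.coe_smul, act_smul_right]

/-- With zero support the projector is `0` and any positive constant serves. This covers dimension
one. -/
theorem isTight_of_frameOp₀_eq_zero (h : F.frameOp₀ = 0) : F.IsTight := by
  refine ⟨1, one_pos, 0, ⟨IsStarProjection.zero _, by rw [h]⟩, by rw [h, smul_zero]⟩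

end POVM

/-! ### The commutant of `W ⊗ W` -/

section Commutant

variable {d : ℕ}

/-- The action `A ⊗ 1 + 1 ⊗ A` of the Lie algebra. -/
def kronSum (A : Matrix (Fin d) (Fin d) ℂ) : Matrix (I2 d) (I2 d) ℂ :=
  A ⊗ₖ (1 : Matrix (Fin d) (Fin d) ℂ) + (1 : Matrix (Fin d) (Fin d) ℂ) ⊗ₖ A

theorem kronSum_add (A B : Matrix (Fin d) (Fin d) ℂ) :
    kronSum (A + B) = kronSum A + kronSum B := by
  simp only [kronSum, Matrix.add_kronecker, Matrix.kronecker_add]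
  abel

theorem kronSum_smul (c : ℂ) (A : Matrix (Fin d) (Fin d) ℂ) :
    kronSum (c • A) = c • kronSum A := by
  simp only [kronSum, Matrix.smul_kronecker, Matrix.kronecker_smul, smul_add]

variable {Y : Matrix (I2 d) (I2 d) ℂ}

/-- The condition on `c` says `|1 + c| = 1`: the matrix acts by the phase `1 + c` on the range of
`p` and trivially on its complement. -/
theorem one_add_smul_mem_unitaryGroup {p : Matrix (Fin d) (Fin d) ℂ} (hp : p * p = p)
    (hH : p.IsHermitian) {c : ℂ} (hc : c + star c + c * star c = 0) :
    1 + c • p ∈ Matrix.unitaryGroup (Fin d) ℂ := by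
  rw [Matrix.mem_unitaryGroup_iff, Matrix.star_eq_conjTranspose, Matrix.conjTranspose_add,
    Matrix.conjTranspose_smul, Matrix.conjTranspose_one, hH, Matrix.mul_add, Matrix.add_mul,
    Matrix.add_mul, Matrix.one_mul, Matrix.one_mul, Matrix.mul_one, Matrix.smul_mul,
    Matrix.mul_smul, hp]
  have : 1 + c • p + (star c • p + c • star c • p) = 1 + (c + star c + c * star c) • p := by
    module
  rw [this, hc, zero_smul, add_zero]

theorem kronecker_one_add_smul (p : Matrix (Fin d) (Fin d) ℂ) (c : ℂ) :
    (1 + c • p) ⊗ₖ (1 + c • p) = 1 + c • kronSum p + c ^ 2 • (p ⊗ₖ p) := by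
  simp only [kronSum, Matrix.add_kronecker, Matrix.kronecker_add, Matrix.smul_kronecker,
    Matrix.kronecker_smul, Matrix.one_kronecker_one]
  module

theorem commute_kronSum_of_isStarProjection
    (hY : ∀ W ∈ Matrix.unitaryGroup (Fin d) ℂ, (W ⊗ₖ W) * Y = Y * (W ⊗ₖ W))
    {p : Matrix (Fin d) (Fin d) ℂ} (hp : p * p = p) (hH : p.IsHermitian) :
    kronSum p * Y = Y * kronSum p := by
  have key : ∀ c : ℂ, c + star c + c * star c = 0 →
      c • (kronSum p * Y - Y * kronSum p) + c ^ 2 • ((p ⊗ₖ p) * Y - Y * (p ⊗ₖ p)) = 0 :=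
    fun c hc => by
      have h := hY _ (one_add_smul_mem_unitaryGroup hp hH hc)
      rw [kronecker_one_add_smul] at h
      simp only [Matrix.add_mul, Matrix.mul_add, Matrix.one_mul, Matrix.mul_one, Matrix.smul_mul,
        Matrix.mul_smul] at h
      rw [← sub_eq_zero] at h
      rw [← h]
      module
  -- The phases `1 + c = -1` and `1 + c = i` give two linear relations between the commutators with
  -- `kronSum p` and with `p ⊗ p`; eliminating the latter replaces differentiation in the Lie group.
  have h1 := key (-2) (by simp; norm_num)
  have h2 := key (Complex.I - 1) (by
    simp only [star_sub, Complex.star_def, Complex.conj_I, star_one]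
    linear_combination -Complex.I_sq)
  have h3 : (Complex.I - 1) ^ 2 = -2 * Complex.I := by linear_combination Complex.I_sq
  rw [h3] at h2
  rw [← sub_eq_zero]
  have h4 : kronSum p * Y - Y * kronSum p =
      (-Complex.I / 2) • ((-2 : ℂ) • (kronSum p * Y - Y * kronSum p)
        + (-2 : ℂ) ^ 2 • ((p ⊗ₖ p) * Y - Y * (p ⊗ₖ p)))
      - ((Complex.I - 1) • (kronSum p * Y - Y * kronSum p)
        + (-2 * Complex.I) • ((p ⊗ₖ p) * Y - Y * (p ⊗ₖ p))) := by
    module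
  rw [h4, h1, h2, smul_zero, sub_zero]

theorem commute_kronSum_vecMulVec
    (hY : ∀ W ∈ Matrix.unitaryGroup (Fin d) ℂ, (W ⊗ₖ W) * Y = Y * (W ⊗ₖ W)) (v : Fin d → ℂ) :
    kronSum (Matrix.vecMulVec v (star v)) * Y = Y * kronSum (Matrix.vecMulVec v (star v)) := by
  by_cases hv : v = 0
  · simp [hv, kronSum]
  have hr : star v ⬝ᵥ v ≠ 0 := fun h => hv (dotProduct_star_self_eq_zero.1 h)
  have hrs : star (star v ⬝ᵥ v) = star v ⬝ᵥ v := by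
    rw [← Matrix.star_dotProduct_star, star_star]
  have h := commute_kronSum_of_isStarProjection hY
    (p := (star v ⬝ᵥ v)⁻¹ • Matrix.vecMulVec v (star v))
    (by
      rw [Matrix.smul_mul, Matrix.mul_smul, Matrix.vecMulVec_mul_vecMulVec, Matrix.vecMulVec_smul,
        inv_smul_smul₀ hr])
    (by rw [Matrix.IsHermitian, Matrix.conjTranspose_smul, Matrix.conjTranspose_vecMulVec, star_star,
      star_inv₀, hrs])
  rw [kronSum_smul, Matrix.smul_mul, Matrix.mul_smul] at h
  exact smul_right_injective _ (inv_ne_zero hr) h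

theorem commute_kronSum_single
    (hY : ∀ W ∈ Matrix.unitaryGroup (Fin d) ℂ, (W ⊗ₖ W) * Y = Y * (W ⊗ₖ W)) (i j : Fin d) :
    kronSum (Matrix.single i j 1) * Y = Y * kronSum (Matrix.single i j 1) := by
  let x : Fin d → ℂ := Pi.single i 1
  let y : Fin d → ℂ := Pi.single j 1
  let Q : ℂ → Matrix (Fin d) (Fin d) ℂ := fun c => Matrix.vecMulVec (x + c • y) (star (x + c • y))
  -- Polarization: the fourth root of unity `c` enters with weight `c/4`.
  have hQ : Matrix.single i j (1 : ℂ) = (4⁻¹ : ℂ) • Q 1 + (4⁻¹ * Complex.I) • Q Complex.I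
      + (-4⁻¹ : ℂ) • Q (-1) + (-4⁻¹ * Complex.I) • Q (-Complex.I) := by
    rw [Matrix.single_eq_single_vecMulVec_single]
    have hy : star y = y := by simp [y, Pi.star_single]
    have hx : star x = x := by simp [x, Pi.star_single]
    ext a b
    simp only [Q, star_add, star_smul, hx, hy, Matrix.add_apply, Matrix.smul_apply,
      Matrix.vecMulVec_apply, Pi.add_apply, Pi.smul_apply, smul_eq_mul,
      Complex.star_def, map_one, map_neg, Complex.conj_I]
    change x a * y b = _
    ring_nf
    simp only [Complex.I_sq]
    ring
  have h : ∀ c, kronSum (Q c) * Y = Y * kronSum (Q c) := fun c => commute_kronSum_vecMulVec hY _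
  rw [hQ]
  simp only [kronSum_add, kronSum_smul, Matrix.add_mul, Matrix.mul_add, Matrix.smul_mul,
    Matrix.mul_smul, h]

/-- Commutation with `E_{ij} ⊗ 1 + 1 ⊗ E_{ij}`, read entrywise and contracted, shows that the direct
and crossed partial contractions of `Y` are scalar. A further contraction relates `Y (j, b)` and `Y
(b, j)` to them, a linear system of determinant `d² - 1`. -/
theorem apply_of_commute_kronecker
    (hY : ∀ W ∈ Matrix.unitaryGroup (Fin d) ℂ, (W ⊗ₖ W) * Y = Y * (W ⊗ₖ W)) (j b c e : Fin d) :
    (d : ℂ) * ((d : ℂ) ^ 2 - 1) * Y (j, b) (c, e) =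
      (d * (∑ p : I2 d, Y p p) - ∑ p : I2 d, Y p p.swap)
          * ((1 : Matrix (Fin d) (Fin d) ℂ) j c * (1 : Matrix (Fin d) (Fin d) ℂ) b e)
        + (d * (∑ p : I2 d, Y p p.swap) - ∑ p : I2 d, Y p p)
          * ((1 : Matrix (Fin d) (Fin d) ℂ) j e * (1 : Matrix (Fin d) (Fin d) ℂ) b c) := by
  have h : ∀ i j a b c e : Fin d,
      (if i = a then Y (j, b) (c, e) else 0) + (if i = b then Y (a, j) (c, e) else 0) =
      (if j = c then Y (a, b) (i, e) else 0) + if j = e then Y (a, b) (c, i) else 0 :=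
    fun i j a b c e => by
      have h := congrFun (congrFun (commute_kronSum_single hY i j) (a, b)) (c, e)
      rw [kronSum, Matrix.add_mul, Matrix.mul_add] at h
      simp only [Matrix.add_apply, Matrix.mul_apply,
        Matrix.kroneckerMap_apply, Fintype.sum_prod_type, Matrix.single_apply, Matrix.one_apply,
        ite_and, ite_mul, mul_ite, one_mul, mul_one, zero_mul, mul_zero, Finset.sum_ite_irrel,
        Finset.sum_const_zero, Finset.sum_ite_eq, Finset.sum_ite_eq', Finset.mem_univ, if_true] at h
      exact h
  have hZ : ∀ j e, (d : ℂ) * ∑ a, Y (a, j) (a, e) = if j = e then ∑ p : I2 d, Y p p else 0 :=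
    fun j e => by
      have h1 : ∀ b, ∑ a, Y (a, j) (a, e) = if j = e then ∑ a, Y (a, b) (a, b) else 0 := fun b => by
        have := Finset.sum_congr (rfl : (Finset.univ : Finset (Fin d)) = _)
          fun a _ => h b j a b a e
        simpa [Finset.sum_add_distrib, Finset.sum_ite_irrel] using this
      have h2 := Finset.sum_congr (rfl : (Finset.univ : Finset (Fin d)) = _) fun b _ => h1 b
      simpa [Finset.sum_ite_irrel, Fintype.sum_prod_type_right] using h2
  have hZ' : ∀ j c, (d : ℂ) * ∑ a, Y (a, j) (c, a) = if j = c then ∑ p : I2 d, Y p p.swap else 0 :=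
    fun j c => by
      have h1 : ∀ b, ∑ a, Y (a, j) (c, a) = if j = c then ∑ a, Y (a, b) (b, a) else 0 := fun b => by
        have := Finset.sum_congr (rfl : (Finset.univ : Finset (Fin d)) = _)
          fun a _ => h b j a b c a
        rw [Finset.sum_add_distrib, Finset.sum_add_distrib] at this
        simp only [Finset.sum_ite_eq, Finset.mem_univ, if_true, Finset.sum_ite_irrel,
          Finset.sum_const_zero] at this
        rw [add_comm] at this
        exact add_right_cancel this
      have h2 := Finset.sum_congr (rfl : (Finset.univ : Finset (Fin d)) = _) fun b _ => h1 b
      simpa [Finset.sum_ite_irrel, Fintype.sum_prod_type_right] using h2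
  have hm : ∀ j b, (d : ℂ) * (d * Y (j, b) (c, e) + Y (b, j) (c, e)) =
      (if j = c then if b = e then ∑ p : I2 d, Y p p else 0 else 0)
        + if j = e then if b = c then ∑ p : I2 d, Y p p.swap else 0 else 0 := fun j b => by
    have := Finset.sum_congr (rfl : (Finset.univ : Finset (Fin d)) = _) fun a _ => h a j a b c e
    rw [Finset.sum_add_distrib, Finset.sum_add_distrib] at this
    simp only [Finset.sum_ite_eq', Finset.mem_univ, if_true,
      Finset.sum_ite_irrel, Finset.sum_const_zero, Finset.sum_const, Finset.card_univ,
      Fintype.card_fin, nsmul_eq_mul] at this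
    rw [this, mul_add, mul_ite, mul_ite, hZ, hZ', mul_zero]
  -- The relation and its copy with `j` and `b` exchanged form the two-by-two system.
  have e1 := hm j b
  have e2 := hm b j
  simp only [Matrix.one_apply]
  have e3 : (d : ℂ) * ((d : ℂ) ^ 2 - 1) * Y (j, b) (c, e) =
      d * (d * (d * Y (j, b) (c, e) + Y (b, j) (c, e)))
        - d * (d * Y (b, j) (c, e) + Y (j, b) (c, e)) := by ring
  rw [e3, e1, e2]
  split_ifs <;> ring

end Commutant

/-! ### Integration over the projective unitary group -/

section Haar

variable {d : ℕ}

theorem cls_rep (y : PU d) : cls (rep y) = y :=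
  Quotient.out_eq (s := QuotientGroup.leftRel (phases d)) y

theorem cls_mul (V W : U d) : cls (V * W) = cls V * cls W := rfl

theorem exists_smul_of_cls_eq {V W : U d} (h : cls V = cls W) :
    ∃ z : ℂ, z * star z = 1 ∧
      (W : Matrix (Fin d) (Fin d) ℂ) = z • (V : Matrix (Fin d) (Fin d) ℂ) := by
  obtain ⟨z, hz, hVW⟩ := (QuotientGroup.eq (s := phases d)).1 h
  refine ⟨z, by rw [Complex.star_def, Complex.mul_conj', hz]; simp, ?_⟩
  have h1 : W = V * (V⁻¹ * W) := by group
  conv_lhs => rw [h1]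
  rw [Submonoid.coe_mul, hVW, Matrix.mul_smul, Matrix.mul_one]

theorem unitaryState_eq_of_cls_eq {V W : U d} (h : cls V = cls W) :
    unitaryState V = unitaryState W := by
  obtain ⟨z, hz, hW⟩ := exists_smul_of_cls_eq h
  ext p q
  rw [unitaryState_apply, unitaryState_apply, hW]
  simp only [Matrix.smul_apply, smul_eq_mul, star_mul']
  linear_combination -((d : ℂ)⁻¹ * (V : Matrix (Fin d) (Fin d) ℂ) p.1 p.2
    * star ((V : Matrix (Fin d) (Fin d) ℂ) q.1 q.2)) * hz

theorem moment_two_apply (V : U d) (x y z w : Fin 2 → Fin d) : moment 2 V (x, y) (z, w) =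
    (V : Matrix (Fin d) (Fin d) ℂ) (x 0) (z 0) * (V : Matrix (Fin d) (Fin d) ℂ) (x 1) (z 1)
      * (star ((V : Matrix (Fin d) (Fin d) ℂ) (w 0) (y 0))
        * star ((V : Matrix (Fin d) (Fin d) ℂ) (w 1) (y 1))) := by
  simp [moment, tensorPow, Fin.prod_univ_two]

theorem moment_two_eq_of_cls_eq {V W : U d} (h : cls V = cls W) : moment 2 V = moment 2 W := by
  obtain ⟨z, hz, hW⟩ := exists_smul_of_cls_eq h
  ext ⟨x, y⟩ ⟨u, w⟩
  rw [moment_two_apply, moment_two_apply, hW]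
  simp only [Matrix.smul_apply, smul_eq_mul, star_mul']
  linear_combination -((V : Matrix (Fin d) (Fin d) ℂ) (x 0) (u 0)
    * (V : Matrix (Fin d) (Fin d) ℂ) (x 1) (u 1)
      * (star ((V : Matrix (Fin d) (Fin d) ℂ) (w 0) (y 0))
        * star ((V : Matrix (Fin d) (Fin d) ℂ) (w 1) (y 1)))) * (z * star z + 1) * hz

instance : IsProbabilityMeasure (haarPU d) := ⟨Measure.haarMeasure_self⟩

instance : (haarPU d).IsMulLeftInvariant := Measure.isMulLeftInvariant_haarMeasure _

/-- The section `rep` is an arbitrary choice with no regularity; a class function composed with it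
descends through the quotient map. -/
theorem continuous_comp_rep {f : U d → ℂ} (hf : Continuous f)
    (h : ∀ V W, cls V = cls W → f V = f W) : Continuous fun y => f (rep y) := by
  refine (QuotientGroup.isQuotientMap_mk (phases d)).continuous_iff.2 ?_
  convert hf using 1
  funext V
  exact h _ _ (cls_rep (cls V))

theorem integrable_comp_rep {f : U d → ℂ} (hf : Continuous f)
    (h : ∀ V W, cls V = cls W → f V = f W) : Integrable (fun y => f (rep y)) (haarPU d) :=
  (continuous_comp_rep hf h).integrable_of_hasCompactSupport
    (HasCompactSupport.of_compactSpace _)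

theorem integral_comp_mul_rep {f : U d → ℂ} (h : ∀ V W, cls V = cls W → f V = f W) (W : U d) :
    ∫ y, f (W * rep y) ∂(haarPU d) = ∫ y, f (rep y) ∂(haarPU d) := by
  rw [← integral_mul_left_eq_self (fun y => f (rep y)) (cls W)]
  refine integral_congr_ae (ae_of_all _ fun y => h _ _ ?_)
  rw [cls_rep, cls_mul, cls_rep]

/-- The conjugate `(V ⊗ V) X (V ⊗ V)†`. -/
def tensorConj (X : Matrix (I2 d) (I2 d) ℂ) (V : U d) : Matrix (I2 d) (I2 d) ℂ :=
  ((V : Matrix (Fin d) (Fin d) ℂ) ⊗ₖ (V : Matrix (Fin d) (Fin d) ℂ)) * X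
    * ((V : Matrix (Fin d) (Fin d) ℂ) ⊗ₖ (V : Matrix (Fin d) (Fin d) ℂ))ᴴ

theorem tensorConj_mul (X : Matrix (I2 d) (I2 d) ℂ) (W V : U d) :
    tensorConj X (W * V) = tensorConj (tensorConj X V) W := by
  simp only [tensorConj, Submonoid.coe_mul, Matrix.mul_kronecker_mul, Matrix.conjTranspose_mul,
    Matrix.mul_assoc]

theorem tensorConj_eq_of_cls_eq (X : Matrix (I2 d) (I2 d) ℂ) {V W : U d} (h : cls V = cls W) :
    tensorConj X V = tensorConj X W := by
  obtain ⟨z, hz, hW⟩ := exists_smul_of_cls_eq h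
  rw [tensorConj, tensorConj, hW]
  simp only [Matrix.smul_kronecker, Matrix.kronecker_smul, Matrix.conjTranspose_smul,
    Matrix.smul_mul, Matrix.mul_smul, smul_smul]
  rw [show star (z * z) * (z * z) = (z * star z) * (z * star z) by rw [star_mul']; ring, hz,
    one_mul, one_smul]

theorem continuous_tensorConj (X : Matrix (I2 d) (I2 d) ℂ) : Continuous (tensorConj X) := by
  have h : Continuous fun V : U d =>
      (V : Matrix (Fin d) (Fin d) ℂ) ⊗ₖ (V : Matrix (Fin d) (Fin d) ℂ) := by
    refine continuous_matrix fun p q => ?_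
    exact (continuous_subtype_val.matrix_elem p.1 q.1).mul
      (continuous_subtype_val.matrix_elem p.2 q.2)
  exact (h.matrix_mul continuous_const).matrix_mul h.matrix_conjTranspose

theorem integrable_tensorConj (X : Matrix (I2 d) (I2 d) ℂ) (p q : I2 d) :
    Integrable (fun y => tensorConj X (rep y) p q) (haarPU d) :=
  integrable_comp_rep (f := fun V => tensorConj X V p q)
    ((continuous_tensorConj X).matrix_elem p q) fun _ _ h => by
    rw [tensorConj_eq_of_cls_eq X h]

theorem mInt_mul_mul {Ω n : Type*} [MeasurableSpace Ω] [Fintype n] {ν : Measure Ω}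
    {f : Ω → Matrix n n ℂ} (hf : ∀ i j, Integrable (fun x => f x i j) ν) (A B : Matrix n n ℂ) :
    mInt ν (fun x => A * f x * B) = A * mInt ν f * B := by
  ext i j
  simp only [mInt, Matrix.of_apply, Matrix.mul_apply, Finset.sum_mul]
  rw [integral_finsetSum _ fun k _ => integrable_finsetSum _ fun l _ =>
    ((hf l k).const_mul _).mul_const _]
  refine Finset.sum_congr rfl fun k _ => ?_
  rw [integral_finsetSum _ fun l _ => ((hf l k).const_mul _).mul_const _]
  refine Finset.sum_congr rfl fun l _ => ?_
  rw [integral_mul_const, integral_const_mul]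

/-- The Haar average of `(V ⊗ V) X (V ⊗ V)†`. -/
def twirl (X : Matrix (I2 d) (I2 d) ℂ) : Matrix (I2 d) (I2 d) ℂ :=
  mInt (haarPU d) fun y => tensorConj X (rep y)

/-- Conjugating by `W ⊗ W` translates the integrand by `cls W`, which left invariance of the Haar
measure absorbs. -/
theorem tensorConj_twirl (X : Matrix (I2 d) (I2 d) ℂ) (W : U d) :
    tensorConj (twirl X) W = twirl X := by
  rw [twirl, tensorConj, ← mInt_mul_mul (integrable_tensorConj X)]
  ext p q
  refine Eq.trans ?_ (integral_comp_mul_rep (f := fun V => tensorConj X V p q)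
    (fun _ _ h => by rw [tensorConj_eq_of_cls_eq X h]) W)
  simp only [tensorConj_mul]
  rfl

theorem kronecker_mul_twirl (X : Matrix (I2 d) (I2 d) ℂ) {W : Matrix (Fin d) (Fin d) ℂ}
    (hW : W ∈ Matrix.unitaryGroup (Fin d) ℂ) : (W ⊗ₖ W) * twirl X = twirl X * (W ⊗ₖ W) := by
  have h1 : (W ⊗ₖ W)ᴴ * (W ⊗ₖ W) = 1 := by
    rw [Matrix.conjTranspose_kronecker, ← Matrix.mul_kronecker_mul,
      show Wᴴ * W = 1 from Matrix.mem_unitaryGroup_iff'.1 hW, Matrix.one_kronecker_one]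
  conv_rhs => rw [← tensorConj_twirl X ⟨W, hW⟩]
  rw [tensorConj, Matrix.mul_assoc, h1, Matrix.mul_one]

theorem tensorConj_single_apply (V : U d) (i j k l a b c e : Fin d) :
    tensorConj (Matrix.single (a, b) (c, e) 1) V (i, j) (k, l) =
      (V : Matrix (Fin d) (Fin d) ℂ) i a * (V : Matrix (Fin d) (Fin d) ℂ) j b
        * (star ((V : Matrix (Fin d) (Fin d) ℂ) k c)
          * star ((V : Matrix (Fin d) (Fin d) ℂ) l e)) := by
  rw [tensorConj, Matrix.mul_apply, Finset.sum_eq_single (c, e)]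
  · rw [Matrix.mul_single_apply_same, Matrix.conjTranspose_apply]
    simp only [Matrix.kroneckerMap_apply, mul_one, star_mul']
  · intro q _ hq
    rw [Matrix.mul_single_apply_of_ne _ _ _ _ _ hq, zero_mul]
  · simp

theorem one_apply_comm (p q : Fin d) :
    (1 : Matrix (Fin d) (Fin d) ℂ) p q = (1 : Matrix (Fin d) (Fin d) ℂ) q p := by
  simp only [Matrix.one_apply, eq_comm]

theorem sum_mul_star (V : U d) (a c : Fin d) :
    ∑ i, (V : Matrix (Fin d) (Fin d) ℂ) i a * star ((V : Matrix (Fin d) (Fin d) ℂ) i c) =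
      (1 : Matrix (Fin d) (Fin d) ℂ) a c := by
  have h : star (V : Matrix (Fin d) (Fin d) ℂ) * V = 1 := Matrix.mem_unitaryGroup_iff'.1 V.2
  have h1 := congrFun (congrFun h c) a
  simp only [Matrix.mul_apply, Matrix.star_apply] at h1
  rw [one_apply_comm, ← h1]
  exact Finset.sum_congr rfl fun i _ => mul_comm _ _

/-- Orthonormality of the columns of a unitary makes the contracted integrand constant. This and the
swapped version supply the two invariants in `apply_of_commute_kronecker`. -/
theorem sum_twirl_single (a b c e : Fin d) :
    ∑ p : I2 d, twirl (Matrix.single (a, b) (c, e) 1) p p =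
      (1 : Matrix (Fin d) (Fin d) ℂ) a c * (1 : Matrix (Fin d) (Fin d) ℂ) b e := by
  simp only [twirl, mInt, Matrix.of_apply]
  rw [← integral_finsetSum _ fun p _ => integrable_tensorConj _ p p]
  have h : ∀ y : PU d, ∑ p : I2 d, tensorConj (Matrix.single (a, b) (c, e) 1) (rep y) p p =
      (1 : Matrix (Fin d) (Fin d) ℂ) a c * (1 : Matrix (Fin d) (Fin d) ℂ) b e := fun y => by
    rw [← sum_mul_star (rep y), ← sum_mul_star (rep y), Finset.sum_mul_sum, Fintype.sum_prod_type]
    refine Finset.sum_congr rfl fun i _ => Finset.sum_congr rfl fun j _ => ?_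
    rw [tensorConj_single_apply]
    ring
  simp [h]

theorem sum_twirl_single_swap (a b c e : Fin d) :
    ∑ p : I2 d, twirl (Matrix.single (a, b) (c, e) 1) p p.swap =
      (1 : Matrix (Fin d) (Fin d) ℂ) a e * (1 : Matrix (Fin d) (Fin d) ℂ) b c := by
  simp only [twirl, mInt, Matrix.of_apply]
  rw [← integral_finsetSum _ fun p _ => integrable_tensorConj _ p p.swap]
  have h : ∀ y : PU d, ∑ p : I2 d, tensorConj (Matrix.single (a, b) (c, e) 1) (rep y) p p.swap =
      (1 : Matrix (Fin d) (Fin d) ℂ) a e * (1 : Matrix (Fin d) (Fin d) ℂ) b c := fun y => by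
    rw [← sum_mul_star (rep y), ← sum_mul_star (rep y), Finset.sum_mul_sum, Fintype.sum_prod_type]
    refine Finset.sum_congr rfl fun i _ => Finset.sum_congr rfl fun j _ => ?_
    rw [Prod.swap_prod_mk, tensorConj_single_apply]
    ring
  simp [h]

theorem haarMoment_two_apply (x y z w : Fin 2 → Fin d) : haarMoment 2 d (x, y) (z, w) =
    twirl (Matrix.single (z 0, z 1) (y 0, y 1) 1) (x 0, x 1) (w 0, w 1) := by
  simp only [haarMoment, twirl, mInt, Matrix.of_apply, moment_two_apply, tensorConj_single_apply]

/-- The second moment of the Haar measure is the frame superoperator of the tight POVMs. -/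
theorem haarMoment_two_eq (hd : 1 < d) (i a k c j b l e : Fin d) :
    haarMoment 2 d (![i, l], ![c, b]) (![a, e], ![k, j]) =
      (((d : ℂ) ^ 2)⁻¹ • opKetBra (1 : Matrix (I2 d) (I2 d) ℂ) 1
        + ((d : ℂ) ^ 2 - 1)⁻¹ • marginalFreeProj d) ((i, a), (k, c)) ((j, b), (l, e)) := by
  have hd' : (d : ℂ) ≠ 0 := by exact_mod_cast (zero_lt_one.trans hd).ne'
  have h1 : (d : ℂ) ^ 2 - 1 ≠ 0 := by
    rw [sub_ne_zero]; exact_mod_cast (Nat.one_lt_pow two_ne_zero hd).ne'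
  have key := apply_of_commute_kronecker (Y := twirl (Matrix.single (a, e) (c, b) 1))
    (fun W hW => kronecker_mul_twirl _ hW) i l k j
  rw [sum_twirl_single, sum_twirl_single_swap] at key
  have hone : ∀ p q r s : Fin d, opKetBra (1 : Matrix (I2 d) (I2 d) ℂ) 1 ((p, q), (r, s))
      ((j, b), (l, e)) = (1 : Matrix (Fin d) (Fin d) ℂ) p r * (1 : Matrix (Fin d) (Fin d) ℂ) q s
        * ((1 : Matrix (Fin d) (Fin d) ℂ) j l * (1 : Matrix (Fin d) (Fin d) ℂ) b e) :=
    fun p q r s => by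
      rw [opKetBra, Matrix.vecMulVec_apply, Pi.star_apply]
      simp only [opKet, Matrix.one_apply, Prod.mk.injEq]
      split_ifs <;> simp_all
  rw [haarMoment_two_apply]
  simp only [Matrix.cons_val_zero, Matrix.cons_val_one]
  refine mul_left_cancel₀ (mul_ne_zero hd' h1) (key.trans ?_)
  rw [Matrix.add_apply, Matrix.smul_apply, Matrix.smul_apply, hone, marginalFreeProj_apply,
    tracelessProj_apply, tracelessProj_apply, one_apply_comm l j, one_apply_comm e b, one_apply_comm e c, one_apply_comm l k]
  simp only [smul_eq_mul]
  field_simp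
  ring

end Haar

/-- Closedness makes points of `PU d` closed, hence Borel, as the sums over finite outcome spaces
require. -/
theorem isClosed_phases (d : ℕ) : IsClosed (phases d : Set (U d)) := by
  have h : (phases d : Set (U d)) = Subtype.val ⁻¹'
      ((fun z : ℂ => z • (1 : Matrix (Fin d) (Fin d) ℂ)) '' Metric.sphere 0 1) := by
    ext V
    simp only [Set.mem_preimage, Set.mem_image, mem_sphere_zero_iff_norm]
    exact ⟨fun ⟨z, hz, hV⟩ => ⟨z, hz, hV.symm⟩, fun ⟨z, hz, hV⟩ => ⟨z, hz, hV.symm⟩⟩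
  rw [h]
  refine (IsCompact.isClosed ?_).preimage continuous_subtype_val
  exact (isCompact_sphere 0 1).image (by fun_prop)

instance (d : ℕ) : T1Space (PU d) :=
  haveI := isClosed_phases d
  inferInstanceAs (T1Space (U d ⧸ phases d))

/-! ### Tightness versus the second moment condition. -/

namespace POVM

section Moments

variable {X : Type*} [MeasurableSpace X] {d : ℕ} {F : POVM X (I2 d)} {V : X → U d}

/-- Both sides integrate `V_{ia} V_{le}` times the conjugate of `V_{kc} V_{jb}`. The reordering of
indices is a bijection, so equality of moments and equality of superoperators are equivalent. -/
theorem HasUnitaryDensity.frameOp_apply (hV : F.HasUnitaryDensity V) (i a k c j b l e : Fin d) :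
    F.frameOp ((i, a), (k, c)) ((j, b), (l, e)) =
      (((d : ℂ) ^ 2)⁻¹ • mInt F.traceMeasure (fun x => moment 2 (V x)))
        (![i, l], ![c, b]) (![a, e], ![k, j]) := by
  rw [POVM.frameOp_apply, Matrix.smul_apply, mInt, Matrix.of_apply, smul_eq_mul,
    ← integral_const_mul]
  refine integral_congr_ae ?_
  filter_upwards [hV] with x hx
  rw [hx, unitaryState_apply, unitaryState_apply, moment_two_apply]
  simp only [Matrix.cons_val_zero, Matrix.cons_val_one, star_mul', star_star, star_inv₀,
    star_natCast]
  ring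

theorem HasUnitaryDensity.hasHaarSecondMoment_iff (hV : F.HasUnitaryDensity V) (hd : 1 < d) :
    F.HasHaarSecondMoment V ↔
      F.frameOp = ((d : ℂ) ^ 2)⁻¹ • opKetBra (1 : Matrix (I2 d) (I2 d) ℂ) 1
        + ((d : ℂ) ^ 2 - 1)⁻¹ • marginalFreeProj d := by
  constructor
  · intro h
    ext ⟨⟨i, a⟩, ⟨k, c⟩⟩ ⟨⟨j, b⟩, ⟨l, e⟩⟩
    rw [hV.frameOp_apply, ← haarMoment_two_eq hd, show _ = haarMoment 2 d from h]
  · intro h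
    have hvec : ∀ x : Fin 2 → Fin d, x = ![x 0, x 1] := fun x => by
      ext i
      fin_cases i <;> rfl
    rw [HasHaarSecondMoment]
    ext ⟨x, y⟩ ⟨z, w⟩
    rw [hvec x, hvec y, hvec z, hvec w, ← hV.frameOp_apply, h, haarMoment_two_eq hd]

theorem moment_of_dim_one (t : ℕ) (V : U 1) : moment t V = 1 := by
  have hV : (V : Matrix (Fin 1) (Fin 1) ℂ)ᴴ * V = 1 := Matrix.mem_unitaryGroup_iff'.1 V.2
  have hV0 := congrFun (congrFun hV 0) 0
  rw [Matrix.mul_apply, Fin.sum_univ_one, Matrix.conjTranspose_apply, Matrix.one_apply_eq] at hV0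
  ext p q
  rw [Subsingleton.elim q p, Matrix.one_apply_eq]
  simp only [moment, tensorPow, Matrix.kroneckerMap_apply, Matrix.of_apply,
    Matrix.conjTranspose_apply, star_prod, ← Finset.prod_mul_distrib]
  refine Finset.prod_eq_one fun k _ => ?_
  rw [← hV0, mul_comm]
  congr!

theorem hasHaarSecondMoment_of_dim_one {F : POVM X (I2 1)} (V : X → U 1) :
    F.HasHaarSecondMoment V := by
  rw [HasHaarSecondMoment, haarMoment]
  ext p q
  simp only [moment_of_dim_one, mInt, Matrix.smul_apply, Matrix.of_apply, integral_const,
    F.traceMeasure_real_univ]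
  simp

theorem isTight_of_dim_one {F : POVM X (I2 1)} : F.IsTight := by
  refine isTight_of_frameOp₀_eq_zero ?_
  ext p q
  refine integral_eq_zero_of_ae ?_
  filter_upwards [F.trace_density] with x hx
  have h1 : F.density x = 1 := by
    ext i j
    rw [Subsingleton.elim j i, Matrix.one_apply_eq, ← hx, Matrix.trace,
      Fintype.sum_subsingleton _ i, Matrix.diag]
  have h2 : F.density₀ x = 0 := by
    rw [density₀, h1]
    simp
  rw [h2, opKetBra, Matrix.vecMulVec_apply]
  simp [opKet]

/-- A POVM with maximally entangled densities, supported on the unital states, is tight if and only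
if the unitaries have the second moment of the Haar measure. -/
theorem HasUnitaryDensity.isTight_iff (hV : F.HasUnitaryDensity V) (hd : 0 < d)
    (hF : F.frameOp.supp = Submodule.span ℝ (Quc d)) : F.IsTight ↔ F.HasHaarSecondMoment V := by
  have hp := hV.isPureState hd
  -- At `d = 1` the constant `1/(d² - 1)` is meaningless, but both conditions hold unconditionally.
  rcases (Nat.succ_le_of_lt hd).eq_or_lt with h | h
  · obtain rfl : d = 1 := h.symm
    exact iff_of_true isTight_of_dim_one (hasHaarSecondMoment_of_dim_one V)
  · rw [hV.hasHaarSecondMoment_iff h]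
    exact ⟨fun ht => ht.frameOp_eq hp hF h, isTight_of_frameOp_eq hp h⟩

theorem isTight_and_isRankOne_iff (hd : 0 < d)
    (hF : F.frameOp.supp = Submodule.span ℝ (Quc d)) :
    F.IsTight ∧ F.IsRankOne ↔ ∃ V : X → U d, F.HasUnitaryDensity V ∧ F.HasHaarSecondMoment V := by
  constructor
  · rintro ⟨ht, hr⟩
    obtain ⟨V, hV⟩ := exists_hasUnitaryDensity hr hF hd
    exact ⟨V, hV, (hV.isTight_iff hd hF).1 ht⟩
  · rintro ⟨V, hV, hm⟩
    exact ⟨(hV.isTight_iff hd hF).2 hm, hV.isRankOne hd⟩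

end Moments

/-! ### Finite outcome spaces and weighted designs. -/

section Finite

variable {X : Type*} [MeasurableSpace X] [MeasurableSingletonClass X] {d : ℕ} {F : POVM X (I2 d)}

/-- Change of variables for the image of `τ/d²` under `c`: outcomes are grouped by fibre, and
classes of weight zero contribute nothing. -/
theorem finsum_mem_fiber_smul [Fintype X] {E : Type*} [AddCommGroup E] [Module ℝ E]
    (c : X → PU d) (g : PU d → E) :
    ∑ᶠ y ∈ {y | 0 < F.traceMeasure.real {x | c x = y} / (d : ℝ) ^ 2},
        (F.traceMeasure.real {x | c x = y} / (d : ℝ) ^ 2) • g y =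
      ∑ x, (F.traceMeasure.real {x} / (d : ℝ) ^ 2) • g (c x) := by
  classical
  have hw : ∀ y, F.traceMeasure.real {x | c x = y} =
      ∑ x ∈ Finset.univ.filter fun x => c x = y, F.traceMeasure.real {x} := fun y => by
    rw [sum_measureReal_singleton]
    simp
  rw [finsum_mem_eq_sum_of_inter_support_eq (t := Finset.univ.image c),
    ← Finset.sum_fiberwise_of_maps_to (t := Finset.univ.image c) (g := c)
      fun x hx => Finset.mem_image_of_mem c hx]
  · refine Finset.sum_congr rfl fun y _ => ?_
    rw [hw, Finset.sum_div, Finset.sum_smul]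
    refine Finset.sum_congr rfl fun x hx => ?_
    rw [(Finset.mem_filter.1 hx).2]
  · ext y
    simp only [Set.mem_inter_iff, Set.mem_ofPred_eq, Function.mem_support, Finset.coe_image,
      Finset.coe_univ, Set.image_univ, Set.mem_range]
    refine and_congr_left fun hy => iff_of_true ?_ ?_
    · exact lt_of_le_of_ne (by positivity) fun h => hy (by rw [← h, zero_smul])
    · by_contra hc
      have : {x | c x = y} = ∅ := Set.eq_empty_of_forall_notMem fun x hx => hc ⟨x, hx⟩
      exact hy (by simp [this])

/-- Finiteness, the bounds on the weights and their normalization hold automatically since `τ(X) =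
d²`; only the moment equation has content. A free `c` serves both labellings in the final theorem.
-/
theorem isWeightedDesign_iff_hasHaarSecondMoment [Finite X] (hd : 0 < d) {V : X → U d}
    {c : X → PU d} (hc : ∀ x, cls (V x) = c x) :
    IsWeightedDesign 2 {y | 0 < F.traceMeasure.real {x | c x = y} / (d : ℝ) ^ 2}
      (fun y => F.traceMeasure.real {x | c x = y} / (d : ℝ) ^ 2) ↔ F.HasHaarSecondMoment V := by
  have := Fintype.ofFinite X
  have hd' : (0 : ℝ) < (d : ℝ) ^ 2 := by positivity
  have huniv : F.traceMeasure.real Set.univ = (d : ℝ) ^ 2 := by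
    rw [F.traceMeasure_real_univ]
    simp [sq]
  have hsum : ∑ x, F.traceMeasure.real {x} = (d : ℝ) ^ 2 := by
    rw [sum_measureReal_singleton, Finset.coe_univ, huniv]
  have hfin : {y | 0 < F.traceMeasure.real {x | c x = y} / (d : ℝ) ^ 2}.Finite := by
    refine (Set.finite_range c).subset fun y hy => ?_
    by_contra hcy
    have : {x | c x = y} = ∅ := Set.eq_empty_of_forall_notMem fun x hx => hcy ⟨x, hx⟩
    simp [this] at hy
  have hle : ∀ y, F.traceMeasure.real {x | c x = y} / (d : ℝ) ^ 2 ≤ 1 := fun y => by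
    rw [div_le_one hd', ← huniv]
    exact measureReal_mono (Set.subset_univ _)
  have hone := finsum_mem_fiber_smul (F := F) c fun _ => (1 : ℝ)
  simp only [smul_eq_mul, mul_one] at hone
  rw [← Finset.sum_div, hsum, div_self hd'.ne'] at hone
  have hmom := finsum_mem_fiber_smul (F := F) c fun y => moment 2 (rep y)
  have hint : ((d : ℂ) ^ 2)⁻¹ • mInt F.traceMeasure (fun x => moment 2 (V x)) =
      ∑ x, (F.traceMeasure.real {x} / (d : ℝ) ^ 2) • moment 2 (rep (c x)) := by
    have hm : ∀ x, moment 2 (rep (c x)) = moment 2 (V x) := fun x =>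
      moment_two_eq_of_cls_eq (by rw [cls_rep, hc])
    ext p q
    rw [Matrix.smul_apply, mInt, Matrix.of_apply, integral_fintype Integrable.of_finite,
      Matrix.sum_apply, Finset.smul_sum]
    refine Finset.sum_congr rfl fun x _ => ?_
    rw [hm, Matrix.smul_apply, Complex.real_smul, Complex.real_smul, smul_eq_mul]
    push_cast
    ring
  rw [IsWeightedDesign, HasHaarSecondMoment, hint, ← hmom]
  simp only [Complex.coe_smul]
  exact ⟨fun h => h.2.2.2, fun h => ⟨hfin, fun y hy => ⟨hy, hle y⟩, hone, h⟩⟩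

end Finite

end POVM

end QuantumProcess

end

theorem mainTheorem1 (d : ℕ) (hd : 0 < d) (X : Set (QuantumProcess.PU d))
    (F : QuantumProcess.POVM X (QuantumProcess.I2 d))
    (hF : F.frameOp.supp = Submodule.span ℝ (QuantumProcess.Quc d)) :
    -- arbitrary labelling of the outcomes by elements of `X`
    (F.IsTight ∧ F.IsRankOne ↔
      ∃ V : X → QuantumProcess.U d, F.HasUnitaryDensity V ∧ F.HasHaarSecondMoment V) ∧
    (X.Finite → (F.IsTight ∧ F.IsRankOne ↔
      ∃ V : X → QuantumProcess.U d, F.HasUnitaryDensity V ∧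
        QuantumProcess.IsWeightedDesign 2 (F.atoms V) (F.weight V))) ∧
    -- every outcome whose density is a maximally entangled state `|V⟩⟨V|` is labelled by `[V]`
    ((∀ᵐ x ∂F.traceMeasure, ∀ V : QuantumProcess.U d,
        F.density x = QuantumProcess.unitaryState V → QuantumProcess.cls V = x) →
      (F.IsTight ∧ F.IsRankOne ↔
        F.HasUnitaryDensity (fun x => QuantumProcess.rep (x : QuantumProcess.PU d)) ∧
          F.HasHaarSecondMoment (fun x => QuantumProcess.rep (x : QuantumProcess.PU d))) ∧
      (X.Finite → (F.IsTight ∧ F.IsRankOne ↔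
        F.HasUnitaryDensity (fun x => QuantumProcess.rep (x : QuantumProcess.PU d)) ∧
          QuantumProcess.IsWeightedDesign 2
            {y | 0 < F.traceMeasure.real {x : X | (x : QuantumProcess.PU d) = y} / (d : ℝ) ^ 2}
            (fun y => F.traceMeasure.real {x : X | (x : QuantumProcess.PU d) = y} / (d : ℝ) ^ 2)))) := by
  have hex := QuantumProcess.POVM.isTight_and_isRankOne_iff hd hF
  refine ⟨hex, fun hX => ?_, fun hlab => ?_⟩
  · have := hX.to_subtype
    rw [hex]
    exact exists_congr fun V => and_congr_right fun _ =>
      (QuantumProcess.POVM.isWeightedDesign_iff_hasHaarSecondMoment hd fun _ => rfl).symm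
  · have hrep : F.IsTight ∧ F.IsRankOne ↔
        F.HasUnitaryDensity (fun x => QuantumProcess.rep (x : QuantumProcess.PU d)) ∧
          F.HasHaarSecondMoment (fun x => QuantumProcess.rep (x : QuantumProcess.PU d)) := by
      refine ⟨fun h => ?_, fun h => hex.2 ⟨_, h⟩⟩
      obtain ⟨V, hV, -⟩ := hex.1 h
      -- The labelling forces `cls (V x) = x`, so `V x` and `rep x` differ by a phase and define the
      -- same state.
      have hU : F.HasUnitaryDensity
          fun x => QuantumProcess.rep (x : QuantumProcess.PU d) := by
        filter_upwards [hV, hlab] with x hx hl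
        rw [hx]
        exact QuantumProcess.unitaryState_eq_of_cls_eq (by rw [QuantumProcess.cls_rep, hl _ hx])
      exact ⟨hU, (hU.isTight_iff hd hF).1 h.1⟩
    refine ⟨hrep, fun hX => ?_⟩
    have := hX.to_subtype
    rw [hrep]
    exact and_congr_right fun _ =>
      (QuantumProcess.POVM.isWeightedDesign_iff_hasHaarSecondMoment hd
        fun _ => QuantumProcess.cls_rep _).symm
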